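/- Let $\beta>1$. Let $I\subseteq\mathbb R$ be an open interval (possibly $I=\mathbb R$) and let $f\ge 0$ be a probability density on $\mathbb R$ such that (F1) the support of $f$ is a compact subset of $I$; (F2) $f$ is four times continuously differentiable on $I$; (F3) $\int_I f^{(4)}(x)^2 f(x)^{\beta-2}\,dx<\infty$. Let $K:\mathbb R\to\mathbb R$ be an even, bounded, twice continuously differentiable kernel with $\int K=1$, $\int |K(t)|\,dt<\infty$, $\int t^4|K(t)|\,dt<\infty$, $K''$ bounded, and $\int (1+|t|)\,|K''(t)|\,dt<\infty$ (for example the Gaussian density). Write $\mu_j(K)=\int t^jK(t)\,dt$ and $R(K)=\int K(t)^2\,dt$. Let $X_1,X_2,\dots$ be i.i.d. with density $f$, let $h=h_n>0$, and put $$f_n(x)=\frac1{nh}\sum_{i=1}^n K\Big(\frac{x-X_i}{h}\Big),\qquad \hat f_n(x)=f_n(x)-\frac{h^2}{2}\,\mu_2(K)\,f_n''(x).$$ For functions $g$ and $f$ put $$D_\beta(g,f)=\frac1\beta\int_I g^\beta\,dx-\frac1{\beta-1}\int_I g^{\beta-1}f\,dx+\frac1{\beta(\beta-1)}\int_I f^\beta\,dx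 .$$ Since $\hat f_n$ may take negative values, real powers of negative numbers are read as $y^s=|y|^s\cos(\pi s)$ for $y<0$ (the real part of the principal value, and the ordinary power when $s$ is an integer). Define the asymptotic expected $\beta$-divergence by $$A\mathbb E D_\beta(\hat f_n,f)=\frac12\left[\frac{h^8}{576}\,\mu_4(K)^2\int_I f^{\beta-2}(x)\big(f^{(4)}(x)\big)^2dx+\frac1{nh}\,R(K)\int_I f^{\beta-1}(x)\,dx\right].$$ Let $0<c<\frac18$ and suppose that $h_n\to0$, that $(nh_n)^{-1/2}=O(n^{-c})$ and, in case $\beta<\frac32$, that $h_n^4=O(n^{-c})$. (For $h_n$ of exact order $n^{-1/9}$ this holds for every $c\in(0,\frac18)$.) Then $D_\beta(\hat f_n,f)$ is well defined and integrable for every $n\ge1$, the integrals $R(K)$, $\int_I f^\beta$ and $\int_I f^{\beta-1}$ are finite, and as $n\to\infty$ $$\mathbb E D_\beta(\hat f_n,f)=A\mathbb E D_\beta(\hat f_n,f)+O(n^{-c})+O(h_n^6).$$ The same holds with $\hat f_n$ replaced in $D_\beta$ by its positive part $\max(\hat f_n,0)$. -/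

import Mathlib

open MeasureTheory ProbabilityTheory Filter Topology Asymptotics

noncomputable section

/-- A smoothing kernel: an even, twice continuously differentiable function of integral one with a
finite fourth moment, such that the second derivative is bounded and has a finite first absolute
moment (the Gaussian density is an example). Nonnegativity is not required. -/
structure IsSmoothKernel (K : ℝ → ℝ) : Prop where
  contDiff : ContDiff ℝ 2 K
  even : ∀ t, K (-t) = K t
  integrable : Integrable K
  integral_eq_one : ∫ t, K t = 1
  bounded : ∃ M : ℝ, ∀ t, |K t| ≤ M
  moment_four : Integrable (fun t => t ^ 4 * K t)
  bounded_deriv2 : ∃ M : ℝ, ∀ t, |iteratedDeriv 2 K t| ≤ M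
  integrable_deriv2 : Integrable (iteratedDeriv 2 K)
  moment_deriv2 : Integrable (fun t => t * iteratedDeriv 2 K t)

/-- The Parzen kernel estimator `f_n` built from the sample `X 0, …, X (n - 1)`
with bandwidth `h`. -/
def kde (K : ℝ → ℝ) (h : ℝ) (n : ℕ) (X : ℕ → ℝ) (x : ℝ) : ℝ :=
  1 / (n * h) * ∑ i ∈ Finset.range n, K ((x - X i) / h)

/-- The bias reduced estimator `f_n(x) - (h² / 2) f_n''(x) ∫ t² K(t) dt`. -/
def biasReducedKde (K : ℝ → ℝ) (h : ℝ) (n : ℕ) (X : ℕ → ℝ) (x : ℝ) : ℝ :=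
  kde K h n X x - h ^ 2 / 2 * iteratedDeriv 2 (kde K h n X) x * ∫ t, t ^ 2 * K t

/-- The `β`-divergence between `g` and `f`, with integrals over `I`. -/
def betaDivergence (β : ℝ) (I : Set ℝ) (g f : ℝ → ℝ) : ℝ :=
  1 / β * (∫ x in I, g x ^ β)
    - 1 / (β - 1) * (∫ x in I, g x ^ (β - 1) * f x)
    + 1 / (β * (β - 1)) * (∫ x in I, f x ^ β)

/-- The asymptotic expected `β`-divergence at sample size `n` and bandwidth `h`. -/
def asympExpectedBetaDivergence (β : ℝ) (I : Set ℝ) (K f : ℝ → ℝ) (n : ℕ) (h : ℝ) : ℝ :=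
  1 / 2 *
    (h ^ 8 / 576 * (∫ t, t ^ 4 * K t) ^ 2
        * (∫ x in I, f x ^ (β - 2) * (iteratedDeriv 4 f x) ^ 2)
      + 1 / (n * h) * (∫ t, K t ^ 2) * (∫ x in I, f x ^ (β - 1)))

end

/-!
The asymptotic expected divergence is a combination of `h ^ 8` and `1 / (n h)`, and `1 / (n h)` is
the square of `(n h) ^ (-1/2) = O(n ^ (-c))`. It is therefore itself `O(n ^ (-c) + h ^ 6)`
(`isBigO_asympExpectedBetaDivergence`), and the claim amounts to an upper bound of that order for
the expected absolute divergence.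

*The divergence.* Write `g` for the estimator. The integrand `d(g, f)` of the divergence vanishes
together with its `g`-derivative `g ^ (β - 2) (g - f)` at `g = f`. Treating `|g - f| < f / 2` by the
mean value inequality, and the opposite case, which contains all negative `g`, by size alone, gives
`|d(g, f)| ≤ C (|g - f| ^ β + |g - f| ^ min β 2)` for all real `g` and `0 ≤ f ≤ M`
(`exists_abs_divergenceIntegrand_le`). Replacing `g` by its positive part only decreases `|g - f|`.
It remains to bound the integrated moments `𝔼 ∫ |g - f| ^ p` over the line for `p = β` and
`p = min β 2`, both greater than one.

*The bias.* The bias reduced estimator is the Parzen estimator with the kernel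
`L = K - (μ₂(K) / 2) K''`. Integrating by parts twice moves the derivatives from `K` to `f`, and a
Taylor expansion of `f` and `f''` leaves only remainders, because `K` is even and the second order
terms cancel. Such a remainder at `x` and `x - h t` vanishes unless one of the two points lies in
the support of `f`, so the bias is `O(h ^ 4)` both uniformly and in `L¹`
(`TaylorData.exists_kernelBias_le`), hence `O(h ^ 4)` in every `L^p`.

*The stochastic error.* At each `x` this is `(n h) ^ (-1/2)` times a variable `Z` with
`𝔼 (exp Z + exp (-Z) - 2) ≤ C v(x)`, by Bernstein's argument for sums of bounded independent
variables, where `v(x) = ∫ L(t) ^ 2 f(x - h t) dt` (`exists_kde_sub_eq`). For `p ≥ 2` the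
exponential expression dominates `|Z| ^ p`. For `p < 2` truncation at the level `1 / (1 + |x|)`
gives `|Z| ^ p ≤ (1 + |x|) ^ (-p) + (1 + |x|) Z ^ 2`. As `p > 1` and `∫ (1 + |x|) v(x) dx` is
bounded, thanks to the first moment of `L`, the integrated moment is `O((n h) ^ (-p / 2))`
(`exists_lintegral_kde_sub_le`).

Altogether the expected divergence is of order `(n h) ^ (-p / 2) + h ^ (4 p)`. The first term is
`O(n ^ (-c))`. The second is at most `h ^ 6` if `p ≥ 3 / 2`, and at most `h ^ 4` otherwise, which is
where the extra condition on the bandwidth for `β < 3 / 2` enters (`isBigO_error_rate`).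
-/

/-! ### Pointwise inequalities -/

/-- The integrand of the `β`-divergence, as a function of the values of the two functions. -/
noncomputable def divergenceIntegrand (β g f : ℝ) : ℝ :=
  1 / β * g ^ β - 1 / (β - 1) * (g ^ (β - 1) * f) + 1 / (β * (β - 1)) * f ^ β

lemma divergenceIntegrand_self {β f : ℝ} (hβ : 1 < β) (hf : 0 < f) :
    divergenceIntegrand β f f = 0 := by
  have h1 : f ^ (β - 1) * f = f ^ β := by
    rw [← Real.rpow_add_one hf.ne']; simp
  have : β ≠ 0 := by linarith
  have : β - 1 ≠ 0 := by linarith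
  rw [divergenceIntegrand, h1]
  field_simp
  ring

lemma hasDerivAt_divergenceIntegrand {β f u : ℝ} (hβ : 1 < β) (hu : 0 < u) :
    HasDerivAt (fun g => divergenceIntegrand β g f) (u ^ (β - 2) * (u - f)) u := by
  have h1 := (Real.hasDerivAt_rpow_const (x := u) (p := β) (Or.inl hu.ne')).const_mul (1 / β)
  have h2 := ((Real.hasDerivAt_rpow_const (x := u) (p := β - 1) (Or.inl hu.ne')).mul_const
    f).const_mul (1 / (β - 1))
  have h3 := (h1.sub h2).add_const (1 / (β * (β - 1)) * f ^ β)
  refine h3.congr_deriv ?_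
  have e : u ^ (β - 1) = u ^ (β - 2) * u := by
    rw [← Real.rpow_add_one hu.ne']; congr 1; ring
  have e' : β - 1 - 1 = β - 2 := by ring
  have : β ≠ 0 := by linarith
  have : β - 1 ≠ 0 := by linarith
  rw [e', e]
  field_simp

/-- If `g` is within `f / 2` of `f`, the divergence integrand is controlled through its derivative,
which vanishes at `g = f`. -/
lemma abs_divergenceIntegrand_le_of_near {β f g D : ℝ} (hβ : 1 < β) (hf : 0 < f)
    (hg : |g - f| ≤ f / 2)
    (hD : ∀ u, 0 < u → |u - f| ≤ |g - f| → u ^ (β - 2) * |u - f| ≤ D) :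
    |divergenceIntegrand β g f| ≤ D * |g - f| := by
  have hpos : ∀ u ∈ Set.uIcc f g, 0 < u ∧ |u - f| ≤ |g - f| := by
    intro u hu
    have h1 : |u - f| ≤ |g - f| := Set.abs_sub_left_of_mem_uIcc hu
    refine ⟨?_, h1⟩
    have := (abs_le.1 (h1.trans hg)).1
    linarith
  have := (convex_uIcc f g).norm_image_sub_le_of_norm_hasDerivWithin_le
    (f := fun g => divergenceIntegrand β g f) (C := D)
    (fun u hu => (hasDerivAt_divergenceIntegrand hβ (hpos u hu).1).hasDerivWithinAt)
    (fun u hu => by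
      rw [Real.norm_eq_abs, abs_mul, abs_of_nonneg (Real.rpow_nonneg (hpos u hu).1.le _)]
      exact hD u (hpos u hu).1 (hpos u hu).2)
    Set.left_mem_uIcc Set.right_mem_uIcc
  simpa [divergenceIntegrand_self hβ hf] using this

/-- If `g` is at distance at least `f / 2` from `f`, each of the three terms of the divergence
integrand is at most a multiple of `|g - f| ^ β`; this includes the negative values of `g`. -/
lemma abs_divergenceIntegrand_le_of_far {β f g : ℝ} (hβ : 1 < β) (hf : 0 ≤ f)
    (hg : f / 2 ≤ |g - f|) :
    |divergenceIntegrand β g f| ≤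
      (1 / β * 3 ^ β + 1 / (β - 1) * (3 ^ (β - 1) * 2) + 1 / (β * (β - 1)) * 2 ^ β)
        * |g - f| ^ β := by
  set z := |g - f| with hz
  have hz0 : 0 ≤ z := abs_nonneg _
  have hf2 : f ≤ 2 * z := by linarith
  have hg3 : |g| ≤ 3 * z := by
    have : |g| ≤ |g - f| + |f| := by simpa using abs_add_le (g - f) f
    rw [abs_of_nonneg hf] at this
    linarith
  have hb1 : 0 < β - 1 := by linarith
  have hb0 : 0 < β := by linarith
  have t1 : |g ^ β| ≤ 3 ^ β * z ^ β := by
    rw [← Real.mul_rpow (by norm_num) hz0]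
    exact (Real.abs_rpow_le_abs_rpow _ _).trans (Real.rpow_le_rpow (abs_nonneg _) hg3 hb0.le)
  have t2 : |g ^ (β - 1) * f| ≤ 3 ^ (β - 1) * 2 * z ^ β := by
    rw [abs_mul, abs_of_nonneg hf]
    have e : z ^ β = z ^ (β - 1) * z := by
      rcases hz0.eq_or_lt with h | h
      · rw [← h]; simp [hb0.ne']
      · rw [← Real.rpow_add_one h.ne']; congr 1; ring
    calc |g ^ (β - 1)| * f ≤ (3 * z) ^ (β - 1) * (2 * z) := by
          gcongr
          exact (Real.abs_rpow_le_abs_rpow _ _).trans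
            (Real.rpow_le_rpow (abs_nonneg _) hg3 hb1.le)
      _ = _ := by rw [Real.mul_rpow (by norm_num) hz0, e]; ring
  have t3 : |f ^ β| ≤ 2 ^ β * z ^ β := by
    rw [← Real.mul_rpow (by norm_num) hz0, abs_of_nonneg (Real.rpow_nonneg hf _)]
    exact Real.rpow_le_rpow hf hf2 hb0.le
  unfold divergenceIntegrand
  calc _ ≤ |1 / β * g ^ β| + |1 / (β - 1) * (g ^ (β - 1) * f)|
          + |1 / (β * (β - 1)) * f ^ β| :=
        (abs_add_le _ _).trans (by gcongr; exact abs_sub _ _)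
    _ = 1 / β * |g ^ β| + 1 / (β - 1) * |g ^ (β - 1) * f|
          + 1 / (β * (β - 1)) * |f ^ β| := by
        rw [abs_mul (1 / β), abs_mul (1 / (β - 1)), abs_mul (1 / (β * (β - 1))),
          abs_of_pos (a := 1 / β) (by positivity), abs_of_pos (a := 1 / (β - 1)) (by positivity),
          abs_of_pos (a := 1 / (β * (β - 1))) (by positivity)]
    _ ≤ 1 / β * (3 ^ β * z ^ β) + 1 / (β - 1) * (3 ^ (β - 1) * 2 * z ^ β)
          + 1 / (β * (β - 1)) * (2 ^ β * z ^ β) := by gcongr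
    _ = _ := by ring

/-- The divergence integrand is of order `|g - f| ^ β` for `β ≤ 2`, and of order
`|g - f| ^ β + |g - f| ^ 2` for `β ≥ 2`, uniformly in bounded `f ≥ 0` and in real `g`. -/
lemma exists_abs_divergenceIntegrand_le {β M : ℝ} (hβ : 1 < β) (hM : 0 ≤ M) :
    ∃ C, 0 ≤ C ∧ ∀ g f, 0 ≤ f → f ≤ M →
      |divergenceIntegrand β g f| ≤ C * (|g - f| ^ β + |g - f| ^ min β 2) := by
  have hb1 : 0 < β - 1 := by linarith
  have hb0 : 0 < β := by linarith
  set C₀ := 1 / β * 3 ^ β + 1 / (β - 1) * (3 ^ (β - 1) * 2) + 1 / (β * (β - 1)) * 2 ^ β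
  have hC₀ : 0 ≤ C₀ := by positivity
  refine ⟨C₀ + 1 + (2 * M) ^ (β - 2), by positivity, fun g f hf hfM => ?_⟩
  have hM2 : 0 ≤ (2 * M) ^ (β - 2) := by positivity
  have hzβ : 0 ≤ |g - f| ^ β := by positivity
  have hzm : 0 ≤ |g - f| ^ min β 2 := by positivity
  rcases le_or_gt (f / 2) |g - f| with h | h
  · refine (abs_divergenceIntegrand_le_of_far hβ hf h).trans ?_
    exact mul_le_mul (by linarith) (by linarith) hzβ (by positivity)
  · have hfpos : 0 < f := by linarith [abs_nonneg (g - f)]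
    rcases le_total β 2 with hβ2 | hβ2
    · have key := abs_divergenceIntegrand_le_of_near (D := |g - f| ^ (β - 1)) hβ hfpos h.le ?_
      · have e : |g - f| ^ (β - 1) * |g - f| = |g - f| ^ β := by
          rcases (abs_nonneg (g - f)).eq_or_lt with h | h
          · rw [← h]; simp [hb0.ne']
          · rw [← Real.rpow_add_one h.ne']; congr 1; ring
        rw [e] at key
        exact key.trans (le_trans (by linarith) (mul_le_mul (a := 1) (by linarith)
          (le_add_of_nonneg_right hzm) hzβ (by positivity)))
      · intro u hu huf
        refine le_trans ?_ (Real.rpow_le_rpow (abs_nonneg _) huf hb1.le)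
        rcases (abs_nonneg (u - f)).eq_or_lt with h0 | h0
        · rw [← h0]; simp [hb1.ne']
        · have hle : |u - f| ≤ u := by
            have := (abs_le.1 (huf.trans h.le)).1
            linarith
          calc u ^ (β - 2) * |u - f| ≤ |u - f| ^ (β - 2) * |u - f| := by
                gcongr ?_ * _
                exact Real.rpow_le_rpow_of_nonpos h0 hle (by linarith)
            _ = _ := by rw [← Real.rpow_add_one h0.ne']; congr 1; ring
    · have key := abs_divergenceIntegrand_le_of_near (D := (2 * M) ^ (β - 2) * |g - f|)
        hβ hfpos h.le ?_
      · rw [min_eq_right hβ2] at hzm ⊢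
        have e : |g - f| ^ (2 : ℝ) = |g - f| * |g - f| := by
          rw [Real.rpow_two, sq]
        rw [mul_assoc, ← e] at key
        exact key.trans (mul_le_mul (by linarith) (by linarith) hzm (by positivity))
      · intro u hu huf
        have := (abs_le.1 (huf.trans h.le)).2
        gcongr
        linarith

lemma pow_div_factorial_le_exp_add_exp_neg {z : ℝ} {m : ℕ} (hm : 2 ≤ m) :
    |z| ^ m / m.factorial ≤ Real.exp z + Real.exp (-z) - 2 := by
  wlog hz : 0 ≤ z generalizing z
  · have := this (z := -z) (by linarith)
    rw [abs_neg, neg_neg] at this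
    linarith
  rw [abs_of_nonneg hz]
  have h1 := Real.sum_le_exp_of_nonneg hz (m + 1)
  have h2 := Real.add_one_le_exp (-z)
  rw [Finset.sum_range_succ] at h1
  have h3 : 1 + z ≤ ∑ i ∈ Finset.range m, z ^ i / (i.factorial : ℝ) := by
    calc 1 + z = ∑ i ∈ Finset.range 2, z ^ i / (i.factorial : ℝ) := by
          simp [Finset.sum_range_succ]
      _ ≤ _ := Finset.sum_le_sum_of_subset_of_nonneg
          (Finset.range_mono hm) (fun i _ _ => by positivity)
  linarith

lemma exists_abs_rpow_le_exp_add_exp_neg {p : ℝ} (hp : 2 ≤ p) :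
    ∃ C, 0 ≤ C ∧ ∀ z : ℝ, |z| ^ p ≤ C * (Real.exp z + Real.exp (-z) - 2) := by
  set m := ⌈p⌉₊
  have hm : 2 ≤ m := by
    have : (2 : ℝ) ≤ m := hp.trans (Nat.le_ceil p)
    exact_mod_cast this
  refine ⟨2 + m.factorial, by positivity, fun z => ?_⟩
  have h2 := pow_div_factorial_le_exp_add_exp_neg (z := z) le_rfl
  have h3 := pow_div_factorial_le_exp_add_exp_neg (z := z) hm
  rw [div_le_iff₀ (by positivity)] at h2 h3
  have h4 : |z| ^ p ≤ |z| ^ 2 + |z| ^ m := by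
    rcases le_total |z| 1 with h | h
    · have : |z| ^ p ≤ |z| ^ (2 : ℝ) :=
        Real.rpow_le_rpow_of_exponent_ge' (abs_nonneg _) h (by norm_num) hp
      rw [Real.rpow_two] at this
      have : 0 ≤ |z| ^ m := by positivity
      linarith
    · have : |z| ^ p ≤ |z| ^ (m : ℝ) := Real.rpow_le_rpow_of_exponent_le h (Nat.le_ceil p)
      rw [Real.rpow_natCast] at this
      have : 0 ≤ |z| ^ 2 := by positivity
      linarith
  rw [Nat.factorial_two, Nat.cast_two] at h2
  linarith

/-- A truncation at level `a`: an absolute moment of order `p ≤ 2` in terms of the second one. -/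
lemma abs_rpow_le_rpow_add {p a z : ℝ} (hp0 : 0 ≤ p) (hp : p ≤ 2) (ha : 0 < a) :
    |z| ^ p ≤ a ^ p + a ^ (p - 2) * z ^ 2 := by
  rcases le_total |z| a with h | h
  · have h1 := Real.rpow_le_rpow (abs_nonneg z) h hp0
    have : 0 ≤ a ^ (p - 2) * z ^ 2 := by positivity
    linarith
  · have hz : 0 < |z| := ha.trans_le h
    have h1 : |z| ^ (p - 2) ≤ a ^ (p - 2) := Real.rpow_le_rpow_of_nonpos ha h (by linarith)
    have e : |z| ^ p = |z| ^ (p - 2) * z ^ 2 := by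
      rw [← sq_abs z, ← Real.rpow_two, ← Real.rpow_add hz]; congr 1; ring
    have : 0 ≤ a ^ p := by positivity
    rw [e]
    have := mul_le_mul_of_nonneg_right h1 (sq_nonneg z)
    linarith

lemma abs_add_rpow_le {p : ℝ} (hp : 0 ≤ p) (a b : ℝ) :
    |a + b| ^ p ≤ 2 ^ p * (|a| ^ p + |b| ^ p) := by
  have h1 : |a + b| ≤ 2 * max |a| |b| :=
    (abs_add_le a b).trans (by linarith [le_max_left |a| |b|, le_max_right |a| |b|])
  refine (Real.rpow_le_rpow (abs_nonneg _) h1 hp).trans ?_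
  rw [Real.mul_rpow (by norm_num) (by positivity)]
  gcongr
  have ha : 0 ≤ |a| ^ p := by positivity
  have hb : 0 ≤ |b| ^ p := by positivity
  rcases max_cases |a| |b| with h | h <;> rw [h.1] <;> linarith

/-! ### The effective kernel of the bias reduced estimator -/

/-- The kernel `L = K - (μ₂(K) / 2) K''`: the bias reduced estimator is the Parzen estimator built
with this kernel. -/
noncomputable def biasReducedKernel (K : ℝ → ℝ) (t : ℝ) : ℝ :=
  K t - (∫ s, s ^ 2 * K s) / 2 * iteratedDeriv 2 K t

lemma biasReducedKde_eq {K : ℝ → ℝ} (hK : ContDiff ℝ 2 K) {h : ℝ} (hh : 0 < h) (n : ℕ)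
    (X : ℕ → ℝ) (x : ℝ) :
    biasReducedKde K h n X x = kde (biasReducedKernel K) h n X x := by
  have hone : ∀ a y : ℝ, iteratedDeriv 2 (fun x => K ((x - a) / h)) y
      = h⁻¹ ^ 2 * iteratedDeriv 2 K ((y - a) / h) := by
    intro a y
    have e : (fun x => K ((x - a) / h)) = fun x => (fun y => K (h⁻¹ * y)) (x - a) := by
      funext x; simp only [div_eq_inv_mul]
    rw [e, iteratedDeriv_comp_sub_const 2 (fun y => K (h⁻¹ * y)) a,
      iteratedDeriv_comp_const_mul hK]
    simp only [div_eq_inv_mul]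
  have hcd : ∀ a : ℝ, ContDiff ℝ 2 (fun x => K ((x - a) / h)) := fun a =>
    hK.comp ((contDiff_id.sub contDiff_const).div_const h)
  have hsum : iteratedDeriv 2 (kde K h n X) x
      = 1 / (n * h) * ∑ i ∈ Finset.range n, h⁻¹ ^ 2 * iteratedDeriv 2 K ((x - X i) / h) := by
    have e : kde K h n X = fun x => (1 / (n * h)) * (fun x => ∑ i ∈ Finset.range n,
      K ((x - X i) / h)) x := rfl
    rw [e, iteratedDeriv_const_mul_field, iteratedDeriv_fun_sum]
    · simp only [hone]
    · exact fun i _ => (hcd _).contDiffAt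
  rw [biasReducedKde, hsum, kde, kde]
  simp only [biasReducedKernel, Finset.sum_sub_distrib, ← Finset.mul_sum]
  field_simp

lemma integrable_pow_mul_of_le_four {K : ℝ → ℝ} (hK : Integrable K)
    (hK4 : Integrable (fun t => t ^ 4 * K t)) {j : ℕ} (hj : j ≤ 4) :
    Integrable (fun t => t ^ j * K t) := by
  refine (hK.norm.add hK4.norm).mono' ((continuous_pow j).aestronglyMeasurable.mul
    hK.aestronglyMeasurable) (ae_of_all _ fun t => ?_)
  simp only [Pi.add_apply, Real.norm_eq_abs, abs_mul, abs_pow]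
  have : |t| ^ j ≤ 1 + |t| ^ 4 := by
    rcases le_total |t| 1 with h | h
    · have := pow_le_one₀ (n := j) (abs_nonneg t) h
      have : 0 ≤ |t| ^ 4 := by positivity
      linarith
    · have := pow_le_pow_right₀ h hj
      linarith
  nlinarith [abs_nonneg (K t)]

lemma IsSmoothKernel.continuous_biasReducedKernel {K : ℝ → ℝ} (hK : IsSmoothKernel K) :
    Continuous (biasReducedKernel K) :=
  hK.contDiff.continuous.sub
    (continuous_const.mul (hK.contDiff.continuous_iteratedDeriv 2 le_rfl))

lemma IsSmoothKernel.bounded_biasReducedKernel {K : ℝ → ℝ} (hK : IsSmoothKernel K) :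
    ∃ B : ℝ, 0 < B ∧ ∀ t, |biasReducedKernel K t| ≤ B := by
  obtain ⟨M, hM⟩ := hK.bounded
  obtain ⟨N, hN⟩ := hK.bounded_deriv2
  have hM0 := (abs_nonneg _).trans (hM 0)
  have hN0 := (abs_nonneg _).trans (hN 0)
  refine ⟨M + |(∫ s, s ^ 2 * K s) / 2| * N + 1, by positivity, fun t => ?_⟩
  refine (abs_sub _ _).trans ?_
  rw [abs_mul]
  have := mul_le_mul_of_nonneg_left (hN t) (abs_nonneg ((∫ s, s ^ 2 * K s) / 2))
  linarith [hM t]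

lemma IsSmoothKernel.integrable_biasReducedKernel {K : ℝ → ℝ} (hK : IsSmoothKernel K) :
    Integrable (biasReducedKernel K) :=
  hK.integrable.sub (hK.integrable_deriv2.const_mul _)

lemma IsSmoothKernel.integrable_mul_biasReducedKernel {K : ℝ → ℝ} (hK : IsSmoothKernel K) :
    Integrable (fun t => t * biasReducedKernel K t) := by
  have h1 := integrable_pow_mul_of_le_four hK.integrable hK.moment_four (j := 1) (by norm_num)
  refine (h1.sub (hK.moment_deriv2.const_mul ((∫ s, s ^ 2 * K s) / 2))).congr
    (ae_of_all _ fun t => ?_)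
  simp only [biasReducedKernel, Pi.sub_apply]
  ring

/-! ### The bias -/

lemma integral_eq_zero_of_odd {g : ℝ → ℝ} (hg : ∀ t, g (-t) = -g t) : ∫ t, g t = 0 := by
  have h1 := integral_neg_eq_self g volume
  simp only [hg, integral_neg] at h1
  linarith

lemma abs_le_pow_succ_of_hasDerivAt {r r' : ℝ → ℝ} {C : ℝ} {k : ℕ}
    (hr : ∀ u, HasDerivAt r (r' u) u) (h0 : r 0 = 0) (hr' : ∀ u, |r' u| ≤ C * |u| ^ k) (s : ℝ) :
    |r s| ≤ C * |s| ^ (k + 1) := by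
  have hC : 0 ≤ C := by
    have := (abs_nonneg _).trans (hr' 1)
    simpa using this
  have := (convex_uIcc 0 s).norm_image_sub_le_of_norm_hasDerivWithin_le (f := r)
    (C := C * |s| ^ k) (fun u _ => (hr u).hasDerivWithinAt)
    (fun u hu => by
      have hus : |u| ≤ |s| := by simpa using Set.abs_sub_left_of_mem_uIcc hu
      refine (hr' u).trans ?_
      gcongr)
    Set.left_mem_uIcc Set.right_mem_uIcc
  rw [h0, sub_zero, sub_zero, Real.norm_eq_abs, Real.norm_eq_abs] at this
  rw [pow_succ]
  linarith

/-- A function with compact support in `[-A, A]`, together with its first four derivatives,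
the last of which is bounded by `M`. -/
structure TaylorData (A M : ℝ) (f f₁ f₂ f₃ f₄ : ℝ → ℝ) : Prop where
  d₁ : ∀ x, HasDerivAt f (f₁ x) x
  d₂ : ∀ x, HasDerivAt f₁ (f₂ x) x
  d₃ : ∀ x, HasDerivAt f₂ (f₃ x) x
  d₄ : ∀ x, HasDerivAt f₃ (f₄ x) x
  bound : ∀ x, |f₄ x| ≤ M
  supp : ∀ x, A < |x| → f x = 0 ∧ f₁ x = 0 ∧ f₂ x = 0 ∧ f₃ x = 0

namespace TaylorData

variable {A M : ℝ} {f f₁ f₂ f₃ f₄ : ℝ → ℝ}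

lemma hasDerivAt_sub {φ φ' : ℝ → ℝ} (h : ∀ x, HasDerivAt φ (φ' x) x) (x u : ℝ) :
    HasDerivAt (fun u => φ (x - u)) (-φ' (x - u)) u := by
  simpa using (h (x - u)).comp_const_sub x u

lemma remainder_two_le (hf : TaylorData A M f f₁ f₂ f₃ f₄) (x s : ℝ) :
    |f₂ (x - s) - f₂ x + s * f₃ x| ≤ M * |s| ^ 2 := by
  have h1 : ∀ u, |-f₃ (x - u) + f₃ x| ≤ M * |u| ^ 1 := by
    refine abs_le_pow_succ_of_hasDerivAt (r' := fun u => f₄ (x - u)) (fun u => ?_) (by simp) ?_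
    · simpa using ((hasDerivAt_sub hf.d₄ x u).neg).add_const (f₃ x)
    · intro u; simpa using hf.bound _
  refine abs_le_pow_succ_of_hasDerivAt (r := fun s => f₂ (x - s) - f₂ x + s * f₃ x)
    (fun u => ?_) (by simp) h1 s
  have := ((hasDerivAt_sub hf.d₃ x u).sub_const (f₂ x)).add
    ((hasDerivAt_id u).mul_const (f₃ x))
  exact this.congr_deriv (by ring)

lemma remainder_four_le (hf : TaylorData A M f f₁ f₂ f₃ f₄) (x s : ℝ) :
    |f (x - s) - f x + s * f₁ x - s ^ 2 / 2 * f₂ x + s ^ 3 / 6 * f₃ x| ≤ M * |s| ^ 4 := by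
  have h3 : ∀ u, |-f₁ (x - u) + f₁ x - u * f₂ x + u ^ 2 / 2 * f₃ x| ≤ M * |u| ^ 3 := by
    refine abs_le_pow_succ_of_hasDerivAt (fun u => ?_) (by simp) (hf.remainder_two_le x)
    have := ((((hasDerivAt_sub hf.d₂ x u).neg).add_const (f₁ x)).sub
      ((hasDerivAt_id u).mul_const (f₂ x))).add
        ((((hasDerivAt_id u).pow 2).div_const 2).mul_const (f₃ x))
    refine this.congr_deriv ?_
    simp
  refine abs_le_pow_succ_of_hasDerivAt
    (r := fun s => f (x - s) - f x + s * f₁ x - s ^ 2 / 2 * f₂ x + s ^ 3 / 6 * f₃ x)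
    (fun u => ?_) (by simp) h3 s
  have := ((((hasDerivAt_sub hf.d₁ x u).sub_const (f x)).add
      ((hasDerivAt_id u).mul_const (f₁ x))).sub
        ((((hasDerivAt_id u).pow 2).div_const 2).mul_const (f₂ x))).add
          ((((hasDerivAt_id u).pow 3).div_const 6).mul_const (f₃ x))
  refine this.congr_deriv ?_
  simp only [id]
  push_cast
  ring

lemma continuous_derivs (hf : TaylorData A M f f₁ f₂ f₃ f₄) :
    Continuous f ∧ Continuous f₁ ∧ Continuous f₂ ∧ Continuous f₃ :=
  ⟨continuous_iff_continuousAt.2 fun x => (hf.d₁ x).continuousAt,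
   continuous_iff_continuousAt.2 fun x => (hf.d₂ x).continuousAt,
   continuous_iff_continuousAt.2 fun x => (hf.d₃ x).continuousAt,
   continuous_iff_continuousAt.2 fun x => (hf.d₄ x).continuousAt⟩

end TaylorData

/-- The bias at `x` of the estimator with kernel `L` and bandwidth `h`. -/
noncomputable def kernelBias (L f : ℝ → ℝ) (h x : ℝ) : ℝ :=
  (∫ t, L t * f (x - h * t)) - f x

namespace TaylorData

variable {A M : ℝ} {f f₁ f₂ f₃ f₄ K : ℝ → ℝ}

lemma hasCompactSupport_comp {φ : ℝ → ℝ} (hφ : ∀ x, A < |x| → φ x = 0) {h : ℝ} (hh : 0 < h)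
    (x : ℝ) : HasCompactSupport (fun t => φ (x - h * t)) := by
  refine HasCompactSupport.intro (isCompact_Icc (a := (x - A) / h) (b := (x + A) / h))
    fun t ht => hφ _ ?_
  by_contra! hcon
  refine ht ⟨?_, ?_⟩
  · rw [div_le_iff₀ hh]; linarith [(abs_le.1 hcon).2]
  · rw [le_div_iff₀ hh]; linarith [(abs_le.1 hcon).1]

/-- Two integrations by parts move the derivatives from the kernel to the density. -/
lemma integral_deriv2_mul (hf : TaylorData A M f f₁ f₂ f₃ f₄) (hK : ContDiff ℝ 2 K) {h : ℝ}
    (hh : 0 < h) (x : ℝ) :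
    ∫ t, iteratedDeriv 2 K t * f (x - h * t) = h ^ 2 * ∫ t, K t * f₂ (x - h * t) := by
  obtain ⟨c0, c1, c2, -⟩ := hf.continuous_derivs
  have hd : ∀ {φ φ' : ℝ → ℝ}, (∀ x, HasDerivAt φ (φ' x) x) → ∀ t,
      HasDerivAt (fun t => φ (x - h * t)) (-h * φ' (x - h * t)) t := by
    intro φ φ' H t
    have h1 : HasDerivAt (fun t => x - h * t) (-h) t := by
      simpa using ((hasDerivAt_id t).const_mul h).const_sub x
    have := (H (x - h * t)).comp t h1
    exact this.congr_deriv (by ring)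
  have hK1 : ∀ t, HasDerivAt K (deriv K t) t := fun t =>
    (hK.differentiable (by norm_num) t).hasDerivAt
  have e2 : iteratedDeriv 2 K = deriv (deriv K) := by
    rw [iteratedDeriv_succ, iteratedDeriv_one]
  have hdK : ContDiff ℝ 1 (deriv K) := by
    have : ContDiff ℝ (1 + 1) K := by simpa [one_add_one_eq_two] using hK
    exact (contDiff_succ_iff_deriv.1 this).2.2
  have hK2 : ∀ t, HasDerivAt (deriv K) (iteratedDeriv 2 K t) t := fun t => by
    rw [e2]; exact (hdK.differentiable (by norm_num) t).hasDerivAt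
  have cK := hK.continuous
  have cK1 := hdK.continuous
  have cK2 := hK.continuous_iteratedDeriv 2 le_rfl
  have s0 := hasCompactSupport_comp (fun x hx => (hf.supp x hx).1) hh x
  have s1 := hasCompactSupport_comp (fun x hx => (hf.supp x hx).2.1) hh x
  have s2 := hasCompactSupport_comp (fun x hx => (hf.supp x hx).2.2.1) hh x
  have I1 := integral_mul_deriv_eq_deriv_mul_of_integrable (u := fun t => f (x - h * t))
    (v := deriv K) (fun t _ => hd hf.d₁ t) (fun t _ => hK2 t)
    (Continuous.integrable_of_hasCompactSupport (by fun_prop) s0.mul_right)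
    (Continuous.integrable_of_hasCompactSupport (by fun_prop) (s1.mul_left.mul_right))
    (Continuous.integrable_of_hasCompactSupport (by fun_prop) s0.mul_right)
  have I2 := integral_mul_deriv_eq_deriv_mul_of_integrable (u := fun t => f₁ (x - h * t))
    (v := K) (fun t _ => hd hf.d₂ t) (fun t _ => hK1 t)
    (Continuous.integrable_of_hasCompactSupport (by fun_prop) s1.mul_right)
    (Continuous.integrable_of_hasCompactSupport (by fun_prop) (s2.mul_left.mul_right))
    (Continuous.integrable_of_hasCompactSupport (by fun_prop) s1.mul_right)
  simp only [mul_assoc, integral_const_mul] at I1 I2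
  simp only [mul_comm (iteratedDeriv 2 K _), mul_comm (K _)]
  rw [I1, I2]
  ring

/-- The bias in terms of Taylor remainders. The terms of order two cancel by the choice of the
kernel, those of odd order because `K` is even. -/
lemma kernelBias_eq (hf : TaylorData A M f f₁ f₂ f₃ f₄) (hK : IsSmoothKernel K) {h : ℝ}
    (hh : 0 < h) (x : ℝ) :
    kernelBias (biasReducedKernel K) f h x = ∫ t, K t *
      ((f (x - h * t) - f x + (h * t) * f₁ x - (h * t) ^ 2 / 2 * f₂ x + (h * t) ^ 3 / 6 * f₃ x)
        - h ^ 2 * ((∫ s, s ^ 2 * K s) / 2) *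
          (f₂ (x - h * t) - f₂ x + (h * t) * f₃ x)) := by
  obtain ⟨c0, c1, c2, -⟩ := hf.continuous_derivs
  have cK := hK.contDiff.continuous
  have cK2 := hK.contDiff.continuous_iteratedDeriv 2 le_rfl
  have s0 := hasCompactSupport_comp (fun x hx => (hf.supp x hx).1) hh x
  have s2 := hasCompactSupport_comp (fun x hx => (hf.supp x hx).2.2.1) hh x
  set μ := (∫ s, s ^ 2 * K s) with hμ
  have i0 : Integrable (fun t => K t * f (x - h * t)) :=
    Continuous.integrable_of_hasCompactSupport (by fun_prop) s0.mul_left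
  have i0' : Integrable (fun t => iteratedDeriv 2 K t * f (x - h * t)) :=
    Continuous.integrable_of_hasCompactSupport (by fun_prop) s0.mul_left
  have i2 : Integrable (fun t => K t * f₂ (x - h * t)) :=
    Continuous.integrable_of_hasCompactSupport (by fun_prop) s2.mul_left
  have m : ∀ j ≤ 4, Integrable (fun t => t ^ j * K t) := fun j hj =>
    integrable_pow_mul_of_le_four hK.integrable hK.moment_four hj
  have o1 : ∫ t, t ^ 1 * K t = 0 := integral_eq_zero_of_odd fun t => by rw [hK.even]; ring
  have o3 : ∫ t, t ^ 3 * K t = 0 := integral_eq_zero_of_odd fun t => by rw [hK.even]; ring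
  have lhs : kernelBias (biasReducedKernel K) f h x =
      (∫ t, K t * f (x - h * t)) - μ / 2 * (h ^ 2 * ∫ t, K t * f₂ (x - h * t)) - f x := by
    rw [kernelBias, ← hf.integral_deriv2_mul hK.contDiff hh, ← integral_const_mul,
      ← integral_sub i0 (i0'.const_mul _)]
    congr 2
    funext t
    simp only [biasReducedKernel, ← hμ]
    ring
  have rhs : (fun t => K t *
      ((f (x - h * t) - f x + (h * t) * f₁ x - (h * t) ^ 2 / 2 * f₂ x + (h * t) ^ 3 / 6 * f₃ x)
        - h ^ 2 * (μ / 2) * (f₂ (x - h * t) - f₂ x + (h * t) * f₃ x)))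
      = fun t => K t * f (x - h * t) - (μ / 2 * h ^ 2) * (K t * f₂ (x - h * t))
        + (μ / 2 * h ^ 2 * f₂ x - f x) * (t ^ 0 * K t)
        + (h * f₁ x - μ / 2 * h ^ 3 * f₃ x) * (t ^ 1 * K t)
        - (h ^ 2 / 2 * f₂ x) * (t ^ 2 * K t) + (h ^ 3 / 6 * f₃ x) * (t ^ 3 * K t) := by
    funext t; ring
  rw [lhs, rhs]
  have j0 := i0.sub (i2.const_mul (μ / 2 * h ^ 2))
  have j1 := (m 0 (by norm_num)).const_mul (μ / 2 * h ^ 2 * f₂ x - f x)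
  have j2 := (m 1 (by norm_num)).const_mul (h * f₁ x - μ / 2 * h ^ 3 * f₃ x)
  have j3 := (m 2 (by norm_num)).const_mul (h ^ 2 / 2 * f₂ x)
  have j4 := (m 3 (by norm_num)).const_mul (h ^ 3 / 6 * f₃ x)
  refine Eq.symm ((integral_add' (((j0.add j1).add j2).sub j3) j4).trans ?_)
  rw [integral_sub' ((j0.add j1).add j2) j3, integral_add' (j0.add j1) j2, integral_add' j0 j1,
    integral_sub' i0 (i2.const_mul _)]
  simp only [integral_const_mul, o1, o3, ← hμ]
  simp only [pow_zero, one_mul, hK.integral_eq_one]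
  ring

/-- The remainders vanish unless `x` or `x - h t` lies in `[-A, A]`. -/
lemma norm_kernelBias_integrand_le (hf : TaylorData A M f f₁ f₂ f₃ f₄) (hM : 0 ≤ M) {h : ℝ}
    (μ x t : ℝ) :
    |K t * ((f (x - h * t) - f x + (h * t) * f₁ x - (h * t) ^ 2 / 2 * f₂ x
        + (h * t) ^ 3 / 6 * f₃ x)
        - h ^ 2 * (μ / 2) * (f₂ (x - h * t) - f₂ x + (h * t) * f₃ x))|
      ≤ M * h ^ 4 * (|K t| * (t ^ 4 + |μ / 2| * t ^ 2) *
        ((Set.Icc (-A) A).indicator 1 x + (Set.Icc (-A) A).indicator 1 (x - h * t))) := by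
  have hi : ∀ y, (0 : ℝ) ≤ (Set.Icc (-A) A).indicator 1 y := fun y =>
    Set.indicator_nonneg (fun _ _ => zero_le_one) y
  have r4 := hf.remainder_four_le x (h * t)
  have r2 := hf.remainder_two_le x (h * t)
  rw [abs_mul h t, mul_pow |h|] at r4 r2
  have a2 : ∀ y : ℝ, |y| ^ 4 = y ^ 4 := fun y => by
    rw [← abs_pow, abs_of_nonneg (by positivity)]
  rw [a2, a2] at r4
  rw [sq_abs, sq_abs] at r2
  by_cases hz : A < |x| ∧ A < |x - h * t|
  · obtain ⟨z0, z1, z2, z3⟩ := hf.supp _ hz.1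
    obtain ⟨w0, w1, w2, w3⟩ := hf.supp _ hz.2
    rw [z0, z1, z2, z3, w0, w2]
    simp only [mul_zero, sub_zero, add_zero, abs_zero]
    have := hi x
    have := hi (x - h * t)
    positivity
  · have h1 : (1 : ℝ) ≤
        (Set.Icc (-A) A).indicator 1 x + (Set.Icc (-A) A).indicator 1 (x - h * t) := by
      rw [not_and_or, not_lt, not_lt] at hz
      rcases hz with hz | hz
      · rw [Set.indicator_of_mem (Set.mem_Icc.2 (abs_le.1 hz))]
        exact le_add_of_nonneg_right (hi _)
      · rw [add_comm, Set.indicator_of_mem (Set.mem_Icc.2 (abs_le.1 hz))]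
        exact le_add_of_nonneg_right (hi _)
    have h2 : |K t * ((f (x - h * t) - f x + (h * t) * f₁ x - (h * t) ^ 2 / 2 * f₂ x
        + (h * t) ^ 3 / 6 * f₃ x)
        - h ^ 2 * (μ / 2) * (f₂ (x - h * t) - f₂ x + (h * t) * f₃ x))|
        ≤ M * h ^ 4 * (|K t| * (t ^ 4 + |μ / 2| * t ^ 2)) := by
      rw [abs_mul]
      calc _ ≤ |K t| * (M * (h ^ 4 * t ^ 4) + h ^ 2 * |μ / 2| * (M * (h ^ 2 * t ^ 2))) := by
            gcongr
            refine (abs_sub _ _).trans (add_le_add r4 ?_)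
            rw [abs_mul, abs_mul, abs_of_nonneg (sq_nonneg h)]
            gcongr
        _ = _ := by ring
    refine h2.trans ?_
    rw [← mul_assoc (M * h ^ 4) (|K t| * (t ^ 4 + |μ / 2| * t ^ 2))]
    exact le_mul_of_one_le_right (by positivity) h1

/-- The bias is of order `h⁴`, both uniformly and in mean. -/
lemma exists_kernelBias_le (hf : TaylorData A M f f₁ f₂ f₃ f₄) (hM : 0 ≤ M)
    (hK : IsSmoothKernel K) :
    ∃ D : ℝ, 0 ≤ D ∧ ∀ h, 0 < h →
      (∀ x, |kernelBias (biasReducedKernel K) f h x| ≤ D * h ^ 4) ∧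
      ∫⁻ x, ENNReal.ofReal |kernelBias (biasReducedKernel K) f h x|
        ≤ ENNReal.ofReal (D * h ^ 4) := by
  set μ := (∫ s, s ^ 2 * K s) with hμ
  set κ : ℝ → ℝ := fun t => |K t| * (t ^ 4 + |μ / 2| * t ^ 2) with hκ
  have hκ0 : ∀ t, 0 ≤ κ t := fun t => by positivity
  have hκm : Measurable κ := by
    have := hK.contDiff.continuous
    exact Continuous.measurable (by fun_prop)
  have hκi : Integrable κ := by
    have := hK.moment_four.norm.add ((integrable_pow_mul_of_le_four hK.integrable hK.moment_four
      (j := 2) (by norm_num)).norm.const_mul |μ / 2|)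
    refine this.congr (ae_of_all _ fun t => ?_)
    simp only [Pi.add_apply, norm_mul, Real.norm_eq_abs, hκ]
    rw [abs_of_nonneg (by positivity : 0 ≤ t ^ 4), abs_of_nonneg (sq_nonneg t)]
    ring
  set ω : ℝ → ℝ := (Set.Icc (-A) A).indicator 1 with hω
  have hω0 : ∀ y, 0 ≤ ω y := fun y => Set.indicator_nonneg (fun _ _ => zero_le_one) y
  have hω1 : ∀ y, ω y ≤ 1 := fun y => Set.indicator_le_self' (fun _ _ => zero_le_one) y
  have hωm : Measurable ω := measurable_one.indicator measurableSet_Icc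
  have hωint : ∫⁻ x, ENNReal.ofReal (ω x) = ENNReal.ofReal (A - -A) := by
    rw [← Real.volume_Icc, ← lintegral_indicator_one measurableSet_Icc]
    congr 1
    funext x
    by_cases hx : x ∈ Set.Icc (-A) A <;> simp [hω, hx]
  have hpt : ∀ h, 0 < h → ∀ x, ENNReal.ofReal |kernelBias (biasReducedKernel K) f h x|
      ≤ ENNReal.ofReal (M * h ^ 4) *
        ∫⁻ t, ENNReal.ofReal (κ t) * (ENNReal.ofReal (ω x) + ENNReal.ofReal (ω (x - h * t))) := by
    intro h hh x
    rw [hf.kernelBias_eq hK hh, ← Real.norm_eq_abs, ofReal_norm]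
    refine (enorm_integral_le_lintegral_enorm _).trans ?_
    rw [← lintegral_const_mul']
    · refine lintegral_mono fun t => ?_
      rw [← ofReal_norm, Real.norm_eq_abs, ← ENNReal.ofReal_add (hω0 _) (hω0 _),
        ← ENNReal.ofReal_mul (hκ0 t), ← ENNReal.ofReal_mul (by positivity)]
      exact ENNReal.ofReal_le_ofReal (hf.norm_kernelBias_integrand_le hM μ x t)
    · exact ENNReal.ofReal_ne_top
  have hκl : ∫⁻ t, ENNReal.ofReal (κ t) = ENNReal.ofReal (∫ t, κ t) :=
    (ofReal_integral_eq_lintegral_ofReal hκi (ae_of_all _ hκ0)).symm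
  have hI0 : 0 ≤ ∫ t, κ t := integral_nonneg hκ0
  refine ⟨M * ((∫ t, κ t) * 2) + M * ((∫ t, κ t) * (2 * |A - -A|)), by positivity,
    fun h hh => ⟨fun x => ?_, ?_⟩⟩
  · have h1 : ENNReal.ofReal |kernelBias (biasReducedKernel K) f h x| ≤
        ENNReal.ofReal (M * h ^ 4 * ((∫ t, κ t) * 2)) := by
      refine (hpt h hh x).trans ?_
      rw [ENNReal.ofReal_mul (by positivity : 0 ≤ M * h ^ 4), ENNReal.ofReal_mul hI0, ← hκl,
        ← lintegral_mul_const']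
      · gcongr with t
        rw [← ENNReal.ofReal_add (hω0 _) (hω0 _)]
        exact ENNReal.ofReal_le_ofReal (by linarith [hω1 x, hω1 (x - h * t)])
      · exact ENNReal.ofReal_ne_top
    rw [ENNReal.ofReal_le_ofReal_iff (by positivity)] at h1
    refine h1.trans ?_
    have : 0 ≤ M * ((∫ t, κ t) * (2 * |A - -A|)) * h ^ 4 := by positivity
    linarith
  · have h1 : ∫⁻ x, ENNReal.ofReal |kernelBias (biasReducedKernel K) f h x| ≤
        ENNReal.ofReal (M * h ^ 4 * ((∫ t, κ t) * (2 * |A - -A|))) := by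
      refine (lintegral_mono (hpt h hh)).trans ?_
      rw [lintegral_const_mul' _ _ ENNReal.ofReal_ne_top, lintegral_lintegral_swap]
      · rw [ENNReal.ofReal_mul (by positivity : 0 ≤ M * h ^ 4), ENNReal.ofReal_mul hI0, ← hκl,
          ← lintegral_mul_const' _ _ ENNReal.ofReal_ne_top]
        gcongr with t
        rw [lintegral_const_mul' _ _ ENNReal.ofReal_ne_top]
        gcongr
        rw [lintegral_add_left (by fun_prop),
          lintegral_sub_right_eq_self (fun x => ENNReal.ofReal (ω x)), hωint, two_mul,
          ENNReal.ofReal_add (abs_nonneg _) (abs_nonneg _)]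
        gcongr <;> exact le_abs_self _
      · exact Measurable.aemeasurable (by fun_prop)
    refine h1.trans (ENNReal.ofReal_le_ofReal ?_)
    have : 0 ≤ M * ((∫ t, κ t) * 2) * h ^ 4 := by positivity
    linarith

end TaylorData

/-! ### Exponential moments of sums of bounded independent variables -/

section Bernstein

variable {Ω : Type*} [MeasurableSpace Ω] {P : Measure Ω} [IsProbabilityMeasure P]

/-- Bernstein's bound for one bounded variable. -/
lemma integral_exp_centered_le {Y : Ω → ℝ} (hY : Measurable Y) {B q θ : ℝ}
    (hB : ∀ ω, |Y ω| ≤ B) (hq : ∫ ω, Y ω ^ 2 ∂P ≤ q) (hθ : |θ| * (2 * B) ≤ 1) :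
    Integrable (fun ω => Real.exp (θ * (Y ω - ∫ ω, Y ω ∂P))) P ∧
      ∫ ω, Real.exp (θ * (Y ω - ∫ ω, Y ω ∂P)) ∂P ≤ Real.exp (θ ^ 2 * q) := by
  set m := ∫ ω, Y ω ∂P with hm
  have hYi : Integrable Y P := .of_bound hY.aestronglyMeasurable B (ae_of_all _ hB)
  have hmB : |m| ≤ B := by
    have := norm_integral_le_of_norm_le_const (μ := P) (f := Y) (ae_of_all _ hB)
    simpa using this
  have hu : ∀ ω, |θ * (Y ω - m)| ≤ 1 := fun ω => by
    rw [abs_mul]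
    refine le_trans ?_ hθ
    gcongr
    exact (abs_sub _ _).trans (by linarith [hB ω])
  have hei : Integrable (fun ω => Real.exp (θ * (Y ω - m))) P := by
    refine .of_bound (by fun_prop) (Real.exp 1) (ae_of_all _ fun ω => ?_)
    rw [Real.norm_eq_abs, Real.abs_exp]
    exact Real.exp_le_exp.2 (abs_le.1 (hu ω)).2
  refine ⟨hei, ?_⟩
  have hsi : Integrable (fun ω => (Y ω - m) ^ 2) P := by
    refine .of_bound (by fun_prop) ((2 * B) ^ 2) (ae_of_all _ fun ω => ?_)
    rw [Real.norm_eq_abs, abs_pow]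
    gcongr
    exact (abs_sub _ _).trans (by linarith [hB ω])
  have hli : Integrable (fun ω => Y ω - m) P := hYi.sub (integrable_const _)
  have hvar : ∫ ω, (Y ω - m) ^ 2 ∂P ≤ q := by
    have h1 := variance_le_expectation_sq (X := Y) (μ := P) hY.aestronglyMeasurable
    rw [variance_eq_integral hY.aemeasurable] at h1
    exact h1.trans hq
  calc ∫ ω, Real.exp (θ * (Y ω - m)) ∂P
      ≤ ∫ ω, (1 + θ * (Y ω - m) + θ ^ 2 * (Y ω - m) ^ 2) ∂P := by
        refine integral_mono hei (((integrable_const _).add (hli.const_mul _)).add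
          (hsi.const_mul _)) fun ω => ?_
        have := (abs_le.1 (Real.abs_exp_sub_one_sub_id_le (hu ω))).2
        simp only
        nlinarith
    _ = 1 + θ ^ 2 * ∫ ω, (Y ω - m) ^ 2 ∂P := by
        refine (integral_add' ((integrable_const _).add (hli.const_mul _))
          (hsi.const_mul _)).trans ?_
        rw [integral_add' (integrable_const _) (hli.const_mul _), integral_const_mul,
          integral_const_mul, integral_sub hYi (integrable_const _)]
        simp [← hm]
    _ ≤ 1 + θ ^ 2 * q := by gcongr
    _ ≤ Real.exp (θ ^ 2 * q) := by linarith [Real.add_one_le_exp (θ ^ 2 * q)]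

lemma integral_exp_sum_centered_le {Y : ℕ → Ω → ℝ} (hY : ∀ i, Measurable (Y i))
    (hind : iIndepFun Y P) {B q θ : ℝ} (hB : ∀ i ω, |Y i ω| ≤ B)
    (hq : ∀ i, ∫ ω, Y i ω ^ 2 ∂P ≤ q) (hθ : |θ| * (2 * B) ≤ 1) (n : ℕ) :
    Integrable (fun ω => Real.exp (θ * ∑ i ∈ Finset.range n, (Y i ω - ∫ ω, Y i ω ∂P))) P ∧
    ∫ ω, Real.exp (θ * ∑ i ∈ Finset.range n, (Y i ω - ∫ ω, Y i ω ∂P)) ∂P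
      ≤ Real.exp (n * (θ ^ 2 * q)) := by
  set U : ℕ → Ω → ℝ := fun i ω => Y i ω - ∫ ω, Y i ω ∂P with hU
  have hUm : ∀ i, Measurable (U i) := fun i => (hY i).sub_const _
  have hUind : iIndepFun U P :=
    hind.comp (fun i y => y - ∫ ω, Y i ω ∂P) (fun i => measurable_id.sub_const _)
  have h1 := hUind.mgf_sum (t := θ) hUm (Finset.range n)
  have h2 : mgf (∑ i ∈ Finset.range n, U i) P θ
      = ∫ ω, Real.exp (θ * ∑ i ∈ Finset.range n, (Y i ω - ∫ ω, Y i ω ∂P)) ∂P := by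
    simp [mgf, hU]
  have h3 := hUind.integrable_exp_mul_sum (t := θ) hUm (s := Finset.range n)
    (fun i _ => (integral_exp_centered_le (hY i) (hB i) (hq i) hθ).1)
  refine ⟨by simpa [hU] using h3, ?_⟩
  rw [← h2, h1, Real.exp_nat_mul]
  refine (Finset.prod_le_prod (fun i _ => mgf_nonneg) (g := fun _ => Real.exp (θ ^ 2 * q))
    fun i _ => ?_).trans (by simp)
  exact (integral_exp_centered_le (hY i) (hB i) (hq i) hθ).2

lemma lintegral_exp_add_exp_neg_le {Y : ℕ → Ω → ℝ} (hY : ∀ i, Measurable (Y i))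
    (hind : iIndepFun Y P) {B q θ : ℝ} (hB : ∀ i ω, |Y i ω| ≤ B)
    (hq : ∀ i, ∫ ω, Y i ω ^ 2 ∂P ≤ q) (hθ : |θ| * (2 * B) ≤ 1) (n : ℕ) :
    ∫⁻ ω, ENNReal.ofReal
      (Real.exp (θ * ∑ i ∈ Finset.range n, (Y i ω - ∫ ω, Y i ω ∂P))
        + Real.exp (-(θ * ∑ i ∈ Finset.range n, (Y i ω - ∫ ω, Y i ω ∂P))) - 2) ∂P
      ≤ ENNReal.ofReal (2 * (Real.exp (n * (θ ^ 2 * q)) - 1)) := by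
  obtain ⟨i1, e1⟩ := integral_exp_sum_centered_le hY hind hB hq hθ n
  obtain ⟨i2, e2⟩ := integral_exp_sum_centered_le (θ := -θ) hY hind hB hq (by simpa using hθ) n
  simp only [neg_mul, even_two.neg_pow] at i2 e2
  have hi := (i1.add i2).sub (integrable_const (μ := P) (2 : ℝ))
  have := ofReal_integral_eq_lintegral_ofReal hi (ae_of_all _ fun ω => by
    have := pow_div_factorial_le_exp_add_exp_neg le_rfl
      (z := θ * ∑ i ∈ Finset.range n, (Y i ω - ∫ ω, Y i ω ∂P))
    exact le_trans (by positivity) this)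
  refine (this.symm.le.trans (ENNReal.ofReal_le_ofReal ?_))
  rw [integral_sub' (i1.add i2) (integrable_const _), integral_add' i1 i2]
  simp only [integral_const, probReal_univ, one_smul]
  linarith

end Bernstein

/-- Pointwise control of the absolute moment of order `p > 1` by an exponential moment. For `p < 2`
the truncation level depends on `x` so that the first term is integrable over the line. -/
lemma exists_abs_rpow_le_weighted {p : ℝ} (hp : 1 < p) :
    ∃ C, 0 ≤ C ∧ ∀ x z : ℝ, |z| ^ p ≤ (1 + |x|) ^ (-p)
      + C * ((1 + |x|) * (Real.exp z + Real.exp (-z) - 2)) := by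
  have hΨ : ∀ z : ℝ, z ^ 2 ≤ 2 * (Real.exp z + Real.exp (-z) - 2) := fun z => by
    have := pow_div_factorial_le_exp_add_exp_neg (z := z) le_rfl
    rw [div_le_iff₀ (by positivity), Nat.factorial_two, sq_abs, Nat.cast_two] at this
    linarith
  have hΨ0 : ∀ z : ℝ, 0 ≤ Real.exp z + Real.exp (-z) - 2 := fun z => by
    nlinarith [hΨ z, sq_nonneg z]
  rcases le_total p 2 with hp2 | hp2
  · refine ⟨2, by norm_num, fun x z => ?_⟩
    have hx : 1 ≤ 1 + |x| := by linarith [abs_nonneg x]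
    have hx0 : 0 < 1 + |x| := by linarith
    refine (abs_rpow_le_rpow_add (a := (1 + |x|)⁻¹) (by linarith) hp2 (by positivity)).trans ?_
    rw [Real.inv_rpow hx0.le, Real.inv_rpow hx0.le, ← Real.rpow_neg hx0.le,
      ← Real.rpow_neg hx0.le, neg_sub]
    refine add_le_add le_rfl ?_
    have h1 : (1 + |x|) ^ (2 - p) ≤ 1 + |x| := by
      calc (1 + |x|) ^ (2 - p) ≤ (1 + |x|) ^ (1 : ℝ) :=
            Real.rpow_le_rpow_of_exponent_le hx (by linarith)
        _ = _ := Real.rpow_one _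
    calc (1 + |x|) ^ (2 - p) * z ^ 2
        ≤ (1 + |x|) * (2 * (Real.exp z + Real.exp (-z) - 2)) :=
          mul_le_mul h1 (hΨ z) (sq_nonneg z) hx0.le
      _ = _ := by ring
  · obtain ⟨C, hC, h⟩ := exists_abs_rpow_le_exp_add_exp_neg hp2
    refine ⟨C, hC, fun x z => (h z).trans ?_⟩
    have h1 : 0 ≤ (1 + |x|) ^ (-p) := by positivity
    have h2 : C * (Real.exp z + Real.exp (-z) - 2)
        ≤ C * ((1 + |x|) * (Real.exp z + Real.exp (-z) - 2)) := by
      gcongr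
      exact le_mul_of_one_le_left (hΨ0 z) (by linarith [abs_nonneg x])
    linarith

/-! ### The stochastic error -/

section Density

variable {f : ℝ → ℝ}

lemma integral_comp_eq_integral_mul_density {Ω : Type*} [MeasurableSpace Ω] {P : Measure Ω}
    {X : Ω → ℝ} (hX : Measurable X) (hf : Measurable f) (hf0 : ∀ x, 0 ≤ f x)
    (hlaw : P.map X = volume.withDensity (fun x => ENNReal.ofReal (f x)))
    {φ : ℝ → ℝ} (hφ : Measurable φ) :
    ∫ ω, φ (X ω) ∂P = ∫ y, φ y * f y := by
  rw [← integral_map hX.aemeasurable hφ.aestronglyMeasurable, hlaw,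
    integral_withDensity_eq_integral_toReal_smul (by fun_prop) (ae_of_all _ fun _ => by simp)]
  simp only [smul_eq_mul, ENNReal.toReal_ofReal (hf0 _), mul_comm]

lemma integral_kernel_mul_eq (g : ℝ → ℝ) {h : ℝ} (hh : 0 < h) (x : ℝ) :
    ∫ y, g ((x - y) / h) * f y = h * ∫ t, g t * f (x - h * t) := by
  have h1 := integral_sub_left_eq_self (fun y => g (y / h) * f (x - y)) volume x
  have h2 := Measure.integral_comp_mul_left (fun y => g (y / h) * f (x - y)) h
  simp only [sub_sub_cancel, mul_div_cancel_left₀ _ hh.ne'] at h1 h2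
  rw [h1, h2, abs_of_pos (inv_pos.2 hh), smul_eq_mul, mul_inv_cancel_left₀ hh.ne']

/-- A bounded probability density that vanishes outside `[-A, A]`. -/
structure BoundedDensity (A M : ℝ) (f : ℝ → ℝ) : Prop where
  measurable : Measurable f
  nonneg : ∀ x, 0 ≤ f x
  le : ∀ x, f x ≤ M
  supp : ∀ x, A < |x| → f x = 0
  lintegral : ∫⁻ x, ENNReal.ofReal (f x) = 1

/-- The factor of `1 / (n h)` in the variance bound of the kernel estimator at `x`. -/
noncomputable def kernelVariance (L f : ℝ → ℝ) (h x : ℝ) : ℝ := ∫ t, L t ^ 2 * f (x - h * t)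

lemma kernelVariance_nonneg {L : ℝ → ℝ} (hf : ∀ x, 0 ≤ f x) (h x : ℝ) :
    0 ≤ kernelVariance L f h x :=
  integral_nonneg fun _ => mul_nonneg (sq_nonneg _) (hf _)

variable {L : ℝ → ℝ} {A M B : ℝ}

lemma integrable_sq_of_bounded (hL : Continuous L) (hB : ∀ t, |L t| ≤ B) (hLi : Integrable L) :
    Integrable (fun t => L t ^ 2) := by
  refine (hLi.norm.const_mul B).mono' (by fun_prop) (ae_of_all _ fun t => ?_)
  rw [norm_pow, sq]
  exact mul_le_mul_of_nonneg_right (hB t) (norm_nonneg _)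

lemma kernelVariance_le (hf : BoundedDensity A M f) (hL : Continuous L) (hB : ∀ t, |L t| ≤ B)
    (hLi : Integrable L) (h x : ℝ) : kernelVariance L f h x ≤ M * ∫ t, L t ^ 2 := by
  rw [← integral_const_mul]
  have hi := integrable_sq_of_bounded hL hB hLi
  have hfm := hf.measurable
  refine integral_mono_of_nonneg (ae_of_all _ fun _ => mul_nonneg (sq_nonneg _) (hf.nonneg _))
    (hi.const_mul M) (ae_of_all _ fun t => ?_)
  simp only
  rw [mul_comm M]
  gcongr
  exact hf.le _

lemma lintegral_weighted_kernelVariance_le (hA : 0 ≤ A) (hf : BoundedDensity A M f)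
    (hL : Continuous L)
    (hB : ∀ t, |L t| ≤ B) (hLi : Integrable L) (hLi' : Integrable (fun t => t * L t)) :
    ∃ Q, 0 ≤ Q ∧ ∀ h, 0 < h → h ≤ 1 →
      ∫⁻ x, ENNReal.ofReal ((1 + |x|) * kernelVariance L f h x) ≤ ENNReal.ofReal Q := by
  set g : ℝ → ℝ := fun t => (1 + A + |t|) * L t ^ 2 with hg
  have hg0 : ∀ t, 0 ≤ g t := fun t => by positivity
  have hgi : Integrable g := by
    refine ((hLi.norm.const_mul ((1 + A) * B)).add (hLi'.norm.const_mul B)).mono' (by fun_prop)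
      (ae_of_all _ fun t => ?_)
    rw [Real.norm_eq_abs, abs_of_nonneg (hg0 t)]
    simp only [Pi.add_apply, Real.norm_eq_abs, abs_mul, hg]
    have h1 : L t ^ 2 ≤ B * |L t| := by
      rw [← sq_abs, sq]; exact mul_le_mul_of_nonneg_right (hB t) (abs_nonneg _)
    calc (1 + A + |t|) * L t ^ 2 ≤ (1 + A + |t|) * (B * |L t|) := by gcongr
      _ = _ := by ring
  have hfm := hf.measurable
  refine ⟨∫ t, g t, integral_nonneg hg0, fun h hh hh1 => ?_⟩
  calc ∫⁻ x, ENNReal.ofReal ((1 + |x|) * kernelVariance L f h x)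
      ≤ ∫⁻ x, ∫⁻ t, ENNReal.ofReal (g t) * ENNReal.ofReal (f (x - h * t)) := by
        refine lintegral_mono fun x => ?_
        rw [kernelVariance, ← integral_const_mul]
        refine (ENNReal.ofReal_le_ofReal (le_abs_self _)).trans ?_
        rw [← Real.norm_eq_abs, ofReal_norm]
        refine (enorm_integral_le_lintegral_enorm _).trans (lintegral_mono fun t => ?_)
        rw [← ofReal_norm, ← ENNReal.ofReal_mul (hg0 t)]
        refine ENNReal.ofReal_le_ofReal ?_
        have hft := hf.nonneg (x - h * t)
        rw [Real.norm_eq_abs, abs_of_nonneg (by positivity)]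
        rcases lt_or_ge A |x - h * t| with hx | hx
        · simp [hf.supp _ hx]
        · rw [← mul_assoc]
          refine mul_le_mul_of_nonneg_right (mul_le_mul_of_nonneg_right ?_ (sq_nonneg _)) hft
          have h1 : |x| ≤ |x - h * t| + |h * t| := by simpa using abs_add_le (x - h * t) (h * t)
          have h2 : |h * t| ≤ |t| := by
            rw [abs_mul, abs_of_pos hh]
            exact mul_le_of_le_one_left (abs_nonneg _) hh1
          linarith
    _ = ∫⁻ t, ∫⁻ x, ENNReal.ofReal (g t) * ENNReal.ofReal (f (x - h * t)) :=
        lintegral_lintegral_swap (Measurable.aemeasurable (by fun_prop))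
    _ = ∫⁻ t, ENNReal.ofReal (g t) := by
        congr 1
        funext t
        rw [lintegral_const_mul' _ _ ENNReal.ofReal_ne_top,
          lintegral_sub_right_eq_self (fun x => ENNReal.ofReal (f x)), hf.lintegral, mul_one]
    _ ≤ _ := (ofReal_integral_eq_lintegral_ofReal hgi (ae_of_all _ hg0)).symm.le

end Density

/-! ### Integrated moments of the error -/

section Error

variable {Ω : Type*} [MeasurableSpace Ω] {P : Measure Ω} [IsProbabilityMeasure P]
  {X : ℕ → Ω → ℝ} {f L : ℝ → ℝ} {A M B : ℝ}

lemma exp_sub_one_le_mul_exp {v V : ℝ} (hv : 0 ≤ v) (hV : v ≤ V) :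
    Real.exp v - 1 ≤ v * Real.exp V := by
  have h1 : 1 - v ≤ Real.exp (-v) := by linarith [Real.add_one_le_exp (-v)]
  have h2 : Real.exp (-v) * Real.exp v = 1 := by rw [← Real.exp_add]; simp
  have h3 := mul_le_mul_of_nonneg_right h1 (Real.exp_pos v).le
  have h4 := mul_le_mul_of_nonneg_left (Real.exp_le_exp.2 hV) hv
  nlinarith

/-- The stochastic error at `x` in units of `2 B (n h) ^ (-1/2)` is a sum of centered independent
variables whose exponential moments are controlled by the variance factor at `x`. -/
lemma exists_kde_sub_eq (hX : ∀ i, Measurable (X i)) (hind : iIndepFun X P)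
    (hf : BoundedDensity A M f)
    (hlaw : ∀ i, P.map (X i) = volume.withDensity (fun x => ENNReal.ofReal (f x)))
    (hL : Continuous L) (hB0 : 0 < B) (hB : ∀ t, |L t| ≤ B)
    (hLi : Integrable L) :
    ∃ C, 0 ≤ C ∧ ∀ (n : ℕ) (h : ℝ), 0 < h → 1 ≤ n * h → ∀ x, ∃ Z : Ω → ℝ,
      (∀ ω, kde L h n (fun i => X i ω) x - f x - kernelBias L f h x
        = 2 * B * Real.sqrt (1 / (n * h)) * Z ω) ∧
      ∫⁻ ω, ENNReal.ofReal (Real.exp (Z ω) + Real.exp (-Z ω) - 2) ∂P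
        ≤ ENNReal.ofReal (C * kernelVariance L f h x) := by
  set V := M * (∫ t, L t ^ 2) with hV
  refine ⟨2 * (1 / (2 * B) ^ 2 * Real.exp (1 / (2 * B) ^ 2 * V)), by positivity,
    fun n h hh hnh x => ?_⟩
  set s := Real.sqrt (1 / (n * h)) with hs
  have hnh0 : 0 < n * h := by linarith
  have hn0 : (n : ℝ) ≠ 0 := fun h0 => by simp [h0] at hnh0
  have hs2 : s ^ 2 = 1 / (n * h) := Real.sq_sqrt (by positivity)
  have hs0 : 0 ≤ s := Real.sqrt_nonneg _
  have hs1 : s ≤ 1 := by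
    exact Real.sqrt_le_one.2 ((div_le_one hnh0).2 hnh)
  have hmean : ∀ i, ∫ ω, L ((x - X i ω) / h) ∂P = h * (kernelBias L f h x + f x) := fun i => by
    rw [integral_comp_eq_integral_mul_density (hX i) hf.measurable hf.nonneg (hlaw i)
      (φ := fun y => L ((x - y) / h)) (by fun_prop), integral_kernel_mul_eq L hh, kernelBias]
    ring
  have hsq : ∀ i, ∫ ω, L ((x - X i ω) / h) ^ 2 ∂P ≤ h * kernelVariance L f h x := fun i => by
    rw [integral_comp_eq_integral_mul_density (hX i) hf.measurable hf.nonneg (hlaw i)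
      (φ := fun y => L ((x - y) / h) ^ 2) (by fun_prop),
      integral_kernel_mul_eq (fun t => L t ^ 2) hh, kernelVariance]
  have key := lintegral_exp_add_exp_neg_le (P := P) (Y := fun i ω => L ((x - X i ω) / h))
    (θ := s / (2 * B)) (fun i => by have := hX i; fun_prop)
    (hind.comp (fun _ y => L ((x - y) / h)) (fun _ => by fun_prop)) (fun i ω => hB _) hsq
    (by rw [abs_of_nonneg (by positivity), div_mul_cancel₀ _ (by positivity)]; exact hs1) n
  refine ⟨_, fun ω => ?_, key.trans (ENNReal.ofReal_le_ofReal ?_)⟩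
  · rw [Finset.sum_sub_distrib]
    simp only [hmean, Finset.sum_const, Finset.card_range, nsmul_eq_mul]
    have e : 2 * B * s * (s / (2 * B) * (∑ i ∈ Finset.range n, L ((x - X i ω) / h)
        - n * (h * (kernelBias L f h x + f x))))
        = s ^ 2 * (∑ i ∈ Finset.range n, L ((x - X i ω) / h)
        - n * (h * (kernelBias L f h x + f x))) := by
      field_simp
    rw [e, hs2, kde]
    field_simp
    ring
  · have e : n * ((s / (2 * B)) ^ 2 * (h * kernelVariance L f h x))
        = 1 / (2 * B) ^ 2 * kernelVariance L f h x := by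
      rw [div_pow, hs2]; field_simp
    rw [e]
    have hv0 := kernelVariance_nonneg (L := L) hf.nonneg h x
    have hv1 := kernelVariance_le hf hL hB hLi h x
    have := exp_sub_one_le_mul_exp (v := 1 / (2 * B) ^ 2 * kernelVariance L f h x)
      (V := 1 / (2 * B) ^ 2 * V) (by positivity) (by gcongr)
    nlinarith

/-- The stochastic error in `L^p`, integrated over the whole line, is of order
`(n h) ^ (-p / 2)`. -/
lemma exists_lintegral_kde_sub_le (hX : ∀ i, Measurable (X i)) (hind : iIndepFun X P)
    (hA : 0 ≤ A) (hf : BoundedDensity A M f)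
    (hlaw : ∀ i, P.map (X i) = volume.withDensity (fun x => ENNReal.ofReal (f x)))
    (hL : Continuous L) (hB0 : 0 < B) (hB : ∀ t, |L t| ≤ B)
    (hLi : Integrable L) (hLi' : Integrable (fun t => t * L t)) {p : ℝ} (hp : 1 < p) :
    ∃ C, 0 ≤ C ∧ ∀ (n : ℕ) (h : ℝ), 0 < h → h ≤ 1 → 1 ≤ n * h →
      ∫⁻ x, ∫⁻ ω, ENNReal.ofReal
        (|kde L h n (fun i => X i ω) x - f x - kernelBias L f h x| ^ p) ∂P
        ≤ ENNReal.ofReal (C * Real.sqrt (1 / (n * h)) ^ p) := by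
  obtain ⟨C₁, hC₁, hZ⟩ := exists_kde_sub_eq hX hind hf hlaw hL hB0 hB hLi
  obtain ⟨C₂, hC₂, hW⟩ := exists_abs_rpow_le_weighted hp
  obtain ⟨Q, hQ, hV⟩ := lintegral_weighted_kernelVariance_le hA hf hL hB hLi hLi'
  have hji : Integrable (fun x : ℝ => (1 + |x|) ^ (-p)) := by
    simpa using integrable_one_add_norm (E := ℝ) (μ := volume) (r := p) (by simpa using hp)
  have hj0 : ∀ x : ℝ, 0 ≤ (1 + |x|) ^ (-p) := fun x => by positivity
  set J := ∫ x : ℝ, (1 + |x|) ^ (-p) with hJ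
  have hJ0 : 0 ≤ J := integral_nonneg hj0
  refine ⟨(2 * B) ^ p * (J + C₂ * C₁ * Q), by positivity, fun n h hh hh1 hnh => ?_⟩
  set s := Real.sqrt (1 / (n * h)) with hs
  have hs0 : 0 ≤ s := Real.sqrt_nonneg _
  have hpt : ∀ x, ∫⁻ ω, ENNReal.ofReal
        (|kde L h n (fun i => X i ω) x - f x - kernelBias L f h x| ^ p) ∂P
      ≤ ENNReal.ofReal ((2 * B * s) ^ p) * (ENNReal.ofReal ((1 + |x|) ^ (-p))
        + ENNReal.ofReal (C₂ * C₁) * ENNReal.ofReal ((1 + |x|) * kernelVariance L f h x)) := by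
    intro x
    obtain ⟨Z, e, hΨ⟩ := hZ n h hh hnh x
    have hx0 : 0 ≤ 1 + |x| := by positivity
    calc _ ≤ ∫⁻ ω, ENNReal.ofReal ((2 * B * s) ^ p) * (ENNReal.ofReal ((1 + |x|) ^ (-p))
            + ENNReal.ofReal (C₂ * (1 + |x|)) *
              ENNReal.ofReal (Real.exp (Z ω) + Real.exp (-Z ω) - 2)) ∂P := by
          refine lintegral_mono fun ω => ?_
          have hΨ0 : 0 ≤ Real.exp (Z ω) + Real.exp (-Z ω) - 2 :=
            le_trans (by positivity) (pow_div_factorial_le_exp_add_exp_neg le_rfl)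
          rw [e, ← ENNReal.ofReal_mul (by positivity), ← ENNReal.ofReal_add (hj0 x) (by positivity),
            ← ENNReal.ofReal_mul (by positivity), abs_mul, abs_of_nonneg (by positivity),
            Real.mul_rpow (by positivity) (abs_nonneg _)]
          refine ENNReal.ofReal_le_ofReal ?_
          gcongr
          exact (hW x (Z ω)).trans_eq (by ring)
      _ ≤ _ := by
          rw [lintegral_const_mul' _ _ ENNReal.ofReal_ne_top,
            lintegral_add_left measurable_const, lintegral_const,
            lintegral_const_mul' _ _ ENNReal.ofReal_ne_top, measure_univ, mul_one]
          refine mul_le_mul_right (add_le_add_right ?_ _) _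
          refine (mul_le_mul_right hΨ _).trans_eq ?_
          rw [← ENNReal.ofReal_mul (by positivity), ← ENNReal.ofReal_mul (by positivity)]
          congr 1
          ring
  refine (lintegral_mono hpt).trans ?_
  rw [lintegral_const_mul' _ _ ENNReal.ofReal_ne_top, lintegral_add_left (by fun_prop),
    lintegral_const_mul' _ _ ENNReal.ofReal_ne_top,
    ← ofReal_integral_eq_lintegral_ofReal hji (ae_of_all _ hj0), ← hJ]
  calc _ ≤ ENNReal.ofReal ((2 * B * s) ^ p) * (ENNReal.ofReal J
        + ENNReal.ofReal (C₂ * C₁) * ENNReal.ofReal Q) := by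
        gcongr
        exact hV h hh hh1
    _ = _ := by
        rw [← ENNReal.ofReal_mul (by positivity), ← ENNReal.ofReal_add hJ0 (by positivity),
          ← ENNReal.ofReal_mul (by positivity), Real.mul_rpow (by positivity) hs0]
        congr 1
        ring

/-- A bias that is at most `b` uniformly and in mean is at most `b ^ p` in `L^p`. -/
lemma lintegral_abs_rpow_le {g : ℝ → ℝ} {b p : ℝ} (hp : 1 < p) (hb : 0 ≤ b)
    (h1 : ∀ x, |g x| ≤ b) (h2 : ∫⁻ x, ENNReal.ofReal |g x| ≤ ENNReal.ofReal b) :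
    ∫⁻ x, ENNReal.ofReal (|g x| ^ p) ≤ ENNReal.ofReal (b ^ p) := by
  have e : ∀ y : ℝ, 0 ≤ y → y ^ p = y ^ (p - 1) * y := fun y hy => by
    rcases hy.eq_or_lt with h | h
    · rw [← h]; simp [(by linarith : p ≠ 0)]
    · rw [← Real.rpow_add_one h.ne']; congr 1; ring
  calc ∫⁻ x, ENNReal.ofReal (|g x| ^ p)
      ≤ ∫⁻ x, ENNReal.ofReal (b ^ (p - 1)) * ENNReal.ofReal |g x| := by
        refine lintegral_mono fun x => ?_
        rw [← ENNReal.ofReal_mul (by positivity), e _ (abs_nonneg _)]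
        refine ENNReal.ofReal_le_ofReal (mul_le_mul_of_nonneg_right ?_ (abs_nonneg _))
        exact Real.rpow_le_rpow (abs_nonneg _) (h1 x) (by linarith)
    _ ≤ ENNReal.ofReal (b ^ (p - 1)) * ENNReal.ofReal b := by
        rw [lintegral_const_mul' _ _ ENNReal.ofReal_ne_top]
        gcongr
    _ = _ := by rw [← ENNReal.ofReal_mul (by positivity), ← e b hb]

lemma measurable_kde (hX : ∀ i, Measurable (X i)) (hL : Continuous L) (h : ℝ) (n : ℕ) :
    Measurable (fun z : Ω × ℝ => kde L h n (fun i => X i z.1) z.2) := by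
  unfold kde
  refine (Finset.measurable_sum _ fun i _ => ?_).const_mul _
  have := hX i
  fun_prop

/-- The integrated `p`-th moment of the error of the bias reduced estimator. -/
lemma exists_lintegral_kde_error_le {K f₁ f₂ f₃ f₄ : ℝ → ℝ} {M' : ℝ}
    (hX : ∀ i, Measurable (X i)) (hind : iIndepFun X P)
    (hA : 0 ≤ A) (hf : BoundedDensity A M f) (hM' : 0 ≤ M')
    (hfT : TaylorData A M' f f₁ f₂ f₃ f₄)
    (hlaw : ∀ i, P.map (X i) = volume.withDensity (fun x => ENNReal.ofReal (f x)))
    (hK : IsSmoothKernel K) {p : ℝ} (hp : 1 < p) :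
    ∃ C, 0 ≤ C ∧ ∀ (n : ℕ) (h : ℝ), 0 < h → h ≤ 1 → 1 ≤ n * h →
      ∫⁻ ω, (∫⁻ x, ENNReal.ofReal
        (|kde (biasReducedKernel K) h n (fun i => X i ω) x - f x| ^ p)) ∂P
        ≤ ENNReal.ofReal (C * (Real.sqrt (1 / (n * h)) ^ p + (h ^ 4) ^ p)) := by
  set L := biasReducedKernel K with hLdef
  have hL : Continuous L := hK.continuous_biasReducedKernel
  obtain ⟨B, hB0, hB⟩ := hK.bounded_biasReducedKernel
  obtain ⟨C₁, hC₁, h1⟩ := exists_lintegral_kde_sub_le hX hind hA hf hlaw hL hB0 hB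
    hK.integrable_biasReducedKernel hK.integrable_mul_biasReducedKernel hp
  obtain ⟨D, hD, h2⟩ := hfT.exists_kernelBias_le hM' hK
  refine ⟨2 ^ p * (C₁ + D ^ p), by positivity, fun n h hh hh1 hnh => ?_⟩
  set s := Real.sqrt (1 / (n * h)) with hs
  have hs0 : 0 ≤ s := Real.sqrt_nonneg _
  have hfm := hf.measurable
  have hm : Measurable (fun z : Ω × ℝ => ENNReal.ofReal
      (|kde L h n (fun i => X i z.1) z.2 - f z.2| ^ p)) := by
    have := measurable_kde hX hL h n
    fun_prop
  have hbm : Measurable (kernelBias L f h) := by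
    refine Measurable.sub ?_ hfm
    exact (StronglyMeasurable.integral_prod_right
      (f := fun x t => L t * f (x - h * t))
      (Measurable.stronglyMeasurable (by unfold Function.uncurry; fun_prop))).measurable
  have hb := lintegral_abs_rpow_le hp (by positivity) (h2 h hh).1 (h2 h hh).2
  rw [lintegral_lintegral_swap hm.aemeasurable]
  calc _ ≤ ∫⁻ x, ENNReal.ofReal (2 ^ p) * (ENNReal.ofReal (|kernelBias L f h x| ^ p) +
          ∫⁻ ω, ENNReal.ofReal
            (|kde L h n (fun i => X i ω) x - f x - kernelBias L f h x| ^ p) ∂P) := by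
        refine lintegral_mono fun x => ?_
        refine le_trans (b := ∫⁻ ω, ENNReal.ofReal (2 ^ p) *
          (ENNReal.ofReal (|kernelBias L f h x| ^ p) + ENNReal.ofReal
            (|kde L h n (fun i => X i ω) x - f x - kernelBias L f h x| ^ p)) ∂P) ?_ ?_
        · refine lintegral_mono fun ω => ?_
          rw [← ENNReal.ofReal_add (by positivity) (by positivity),
            ← ENNReal.ofReal_mul (by positivity)]
          refine ENNReal.ofReal_le_ofReal ?_
          have := abs_add_rpow_le (p := p) (by linarith) (kernelBias L f h x)
            (kde L h n (fun i => X i ω) x - f x - kernelBias L f h x)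
          simpa using this
        · rw [lintegral_const_mul' _ _ ENNReal.ofReal_ne_top,
            lintegral_add_left measurable_const, lintegral_const, measure_univ, mul_one]
    _ ≤ ENNReal.ofReal (2 ^ p) * (ENNReal.ofReal ((D * h ^ 4) ^ p) +
          ENNReal.ofReal (C₁ * s ^ p)) := by
        rw [lintegral_const_mul' _ _ ENNReal.ofReal_ne_top, lintegral_add_left (by fun_prop)]
        gcongr
        exact h1 n h hh hh1 hnh
    _ ≤ _ := by
        rw [← ENNReal.ofReal_add (by positivity) (by positivity),
          ← ENNReal.ofReal_mul (by positivity), Real.mul_rpow hD (by positivity)]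
        refine ENNReal.ofReal_le_ofReal ?_
        have a1 : 0 ≤ 2 ^ p * (C₁ * (h ^ 4) ^ p) := by positivity
        have a2 : 0 ≤ 2 ^ p * (D ^ p * s ^ p) := by positivity
        linarith

end Error

/-! ### The divergence as an integral -/

section Divergence

variable {β : ℝ} {I : Set ℝ} {f g : ℝ → ℝ} {A M : ℝ}

lemma BoundedDensity.integrable (hf : BoundedDensity A M f) : Integrable f := by
  refine ⟨hf.measurable.aestronglyMeasurable, ?_⟩
  rw [hasFiniteIntegral_iff_ofReal (ae_of_all _ hf.nonneg), hf.lintegral]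
  exact ENNReal.one_lt_top

lemma BoundedDensity.integrable_rpow (hf : BoundedDensity A M f) {q : ℝ} (hq : 0 < q) :
    Integrable (fun x => f x ^ q) := by
  have hfm := hf.measurable
  have hi : IntegrableOn (fun x => f x ^ q) (Set.Icc (-A) A) := by
    refine Measure.integrableOn_of_bounded (M := M ^ q) isCompact_Icc.measure_lt_top.ne
      (hfm.pow_const q).aestronglyMeasurable (ae_of_all _ fun x => ?_)
    rw [Real.norm_eq_abs, abs_of_nonneg (Real.rpow_nonneg (hf.nonneg x) _)]
    exact Real.rpow_le_rpow (hf.nonneg x) (hf.le x) hq.le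
  refine (integrableOn_iff_integrable_of_support_subset fun x hx => ?_).1 hi
  by_contra hcon
  have : A < |x| := by
    by_contra! h
    exact hcon (abs_le.1 h)
  exact hx (by simp [hf.supp x this, hq.ne'])

lemma integrable_rpow_of_bounded (hβ : 1 < β) (hg : Integrable g) (hgm : Measurable g) {b : ℝ}
    (hb : ∀ x, |g x| ≤ b) :
    Integrable (fun x => g x ^ β) ∧ ∫ x, |g x ^ β| ≤ b ^ (β - 1) * ∫ x, |g x| := by
  have hpt : ∀ x, |g x ^ β| ≤ b ^ (β - 1) * |g x| := fun x => by
    have e : |g x| ^ β = |g x| ^ (β - 1) * |g x| := by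
      rcases (abs_nonneg (g x)).eq_or_lt with h | h
      · rw [← h]; simp [(by linarith : β ≠ 0)]
      · rw [← Real.rpow_add_one h.ne']; congr 1; ring
    refine (Real.abs_rpow_le_abs_rpow _ _).trans (e.trans_le ?_)
    exact mul_le_mul_of_nonneg_right
      (Real.rpow_le_rpow (abs_nonneg _) (hb x) (by linarith)) (abs_nonneg _)
  have hi : Integrable (fun x => g x ^ β) :=
    (hg.abs.const_mul (b ^ (β - 1))).mono' (hgm.pow_const β).aestronglyMeasurable
      (ae_of_all _ hpt)
  refine ⟨hi, ?_⟩
  rw [← integral_const_mul]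
  exact integral_mono hi.abs (hg.abs.const_mul _) hpt

lemma integrable_rpow_mul_of_bounded (hβ : 1 < β) (hgm : Measurable g) {b : ℝ}
    (hb : ∀ x, |g x| ≤ b) (hf : BoundedDensity A M f) :
    Integrable (fun x => g x ^ (β - 1) * f x) ∧
      ∫ x, |g x ^ (β - 1) * f x| ≤ b ^ (β - 1) * ∫ x, f x := by
  have hfm := hf.measurable
  have hpt : ∀ x, |g x ^ (β - 1) * f x| ≤ b ^ (β - 1) * f x := fun x => by
    rw [abs_mul, abs_of_nonneg (hf.nonneg x)]
    refine mul_le_mul_of_nonneg_right ((Real.abs_rpow_le_abs_rpow _ _).trans ?_) (hf.nonneg x)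
    exact Real.rpow_le_rpow (abs_nonneg _) (hb x) (by linarith)
  have hi : Integrable (fun x => g x ^ (β - 1) * f x) :=
    (hf.integrable.const_mul (b ^ (β - 1))).mono' (by fun_prop) (ae_of_all _ hpt)
  refine ⟨hi, ?_⟩
  rw [← integral_const_mul]
  exact integral_mono hi.abs (hf.integrable.const_mul _) hpt

lemma abs_setIntegral_le (u : ℝ → ℝ) (hu : Integrable u) :
    |∫ x in I, u x| ≤ ∫ x, |u x| :=
  abs_integral_le_integral_abs.trans
    (setIntegral_le_integral hu.abs (ae_of_all _ fun x => abs_nonneg (u x)))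

lemma abs_betaDivergence_le (hβ : 1 < β) (hg : Integrable g) (hgm : Measurable g) {b c : ℝ}
    (hb : ∀ x, |g x| ≤ b) (hc : ∫ x, |g x| ≤ c) (hf : BoundedDensity A M f) :
    |betaDivergence β I g f| ≤ 1 / β * (b ^ (β - 1) * c)
      + 1 / (β - 1) * (b ^ (β - 1) * ∫ x, f x)
      + |1 / (β * (β - 1)) * ∫ x in I, f x ^ β| := by
  have hb0 : 0 ≤ b := (abs_nonneg _).trans (hb 0)
  have h1 : 0 < 1 / β := by have : 0 < β := by linarith
                            positivity
  have h2 : 0 < 1 / (β - 1) := by have : 0 < β - 1 := by linarith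
                                  positivity
  obtain ⟨i1, e1⟩ := integrable_rpow_of_bounded hβ hg hgm hb
  obtain ⟨i2, e2⟩ := integrable_rpow_mul_of_bounded hβ hgm hb hf
  unfold betaDivergence
  refine (abs_add_le _ _).trans (add_le_add ((abs_sub _ _).trans (add_le_add ?_ ?_)) le_rfl)
  · rw [abs_mul, abs_of_pos h1]
    gcongr
    exact (abs_setIntegral_le _ i1).trans (e1.trans (by gcongr))
  · rw [abs_mul, abs_of_pos h2]
    gcongr
    exact (abs_setIntegral_le _ i2).trans e2

lemma enorm_betaDivergence_le (hβ : 1 < β) (hg : Integrable g) (hgm : Measurable g) {b : ℝ}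
    (hb : ∀ x, |g x| ≤ b) (hf : BoundedDensity A M f) :
    ‖betaDivergence β I g f‖ₑ ≤ ∫⁻ x, ENNReal.ofReal |divergenceIntegrand β (g x) (f x)| := by
  have i1 := (integrable_rpow_of_bounded hβ hg hgm hb).1.integrableOn (s := I)
  have i2 := (integrable_rpow_mul_of_bounded hβ hgm hb hf).1.integrableOn (s := I)
  have i3 := (hf.integrable_rpow (q := β) (by linarith)).integrableOn (s := I)
  have e : betaDivergence β I g f = ∫ x in I, divergenceIntegrand β (g x) (f x) := by
    refine Eq.symm ((integral_add' ((i1.const_mul (1 / β)).sub (i2.const_mul (1 / (β - 1))))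
      (i3.const_mul (1 / (β * (β - 1))))).trans ?_)
    rw [integral_sub' (i1.const_mul (1 / β)) (i2.const_mul (1 / (β - 1))), integral_const_mul,
      integral_const_mul, integral_const_mul]
    rfl
  rw [e]
  refine (enorm_integral_le_lintegral_enorm _).trans ((setLIntegral_le_lintegral _ _).trans_eq ?_)
  simp only [← ofReal_norm, Real.norm_eq_abs]

end Divergence

/-! ### Bounds for fixed sample size and the passage to expectations -/

section Expectation

variable {L : ℝ → ℝ} {B : ℝ}

lemma abs_kde_le (hB : ∀ t, |L t| ≤ B) {h : ℝ} (hh : 0 < h) (n : ℕ) (X : ℕ → ℝ) (x : ℝ) :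
    |kde L h n X x| ≤ B / h := by
  have hB0 : 0 ≤ B := (abs_nonneg _).trans (hB 0)
  rcases Nat.eq_zero_or_pos n with rfl | hn
  · simp [kde]; positivity
  have hn' : (0 : ℝ) < n := by exact_mod_cast hn
  rw [kde, abs_mul, abs_of_pos (by positivity)]
  calc _ ≤ 1 / (n * h) * (n * B) := by
        gcongr
        refine (Finset.abs_sum_le_sum_abs _ _).trans ?_
        refine (Finset.sum_le_sum fun i _ => hB _).trans (by simp)
    _ = B / h := by field_simp

lemma integrable_comp_sub_div (hLi : Integrable L) {h : ℝ} (hh : 0 < h) (a : ℝ) :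
    Integrable (fun x => L ((x - a) / h)) :=
  (hLi.comp_div hh.ne').comp_sub_right a

lemma integrable_kde (hLi : Integrable L) {h : ℝ} (hh : 0 < h) (n : ℕ) (X : ℕ → ℝ) :
    Integrable (kde L h n X) :=
  (integrable_finsetSum _ fun i _ => integrable_comp_sub_div hLi hh (X i)).const_mul _

lemma integral_abs_kde_le (hLi : Integrable L) {h : ℝ} (hh : 0 < h) (n : ℕ) (X : ℕ → ℝ) :
    ∫ x, |kde L h n X x| ≤ ∫ t, |L t| := by
  have h0 : 0 ≤ ∫ t, |L t| := integral_nonneg fun _ => abs_nonneg _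
  rcases Nat.eq_zero_or_pos n with rfl | hn
  · simpa [kde] using h0
  have hn' : (0 : ℝ) < n := by exact_mod_cast hn
  have hone : ∀ a, ∫ x, |L ((x - a) / h)| = h * ∫ t, |L t| := fun a => by
    rw [integral_sub_right_eq_self (fun x => |L (x / h)|) a,
      Measure.integral_comp_div (fun x => |L x|) h, abs_of_pos hh, smul_eq_mul]
  calc ∫ x, |kde L h n X x|
      ≤ ∫ x, 1 / (n * h) * ∑ i ∈ Finset.range n, |L ((x - X i) / h)| := by
        refine integral_mono (integrable_kde hLi hh n X).abs ((integrable_finsetSum _ fun i _ =>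
          (integrable_comp_sub_div hLi hh (X i)).abs).const_mul _) fun x => ?_
        simp only [kde]
        rw [abs_mul, abs_of_pos (by positivity)]
        gcongr
        exact Finset.abs_sum_le_sum_abs _ _
    _ = ∫ t, |L t| := by
        rw [integral_const_mul, integral_finsetSum _ fun i _ =>
          (integrable_comp_sub_div hLi hh (X i)).abs]
        simp only [hone, Finset.sum_const, Finset.card_range, nsmul_eq_mul]
        field_simp

variable {Ω : Type*} [MeasurableSpace Ω] {P : Measure Ω}
  {X : ℕ → Ω → ℝ} {f T : ℝ → ℝ} {A M β : ℝ} {I : Set ℝ}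

lemma integrable_betaDivergence_kde [IsFiniteMeasure P] (hX : ∀ i, Measurable (X i))
    (hf : BoundedDensity A M f)
    (hL : Continuous L) (hB : ∀ t, |L t| ≤ B) (hLi : Integrable L)
    (hTm : Measurable T) (hT : ∀ y, |T y| ≤ |y|) (hβ : 1 < β) {h : ℝ} (hh : 0 < h) (n : ℕ) :
    Integrable (fun ω => betaDivergence β I (fun x => T (kde L h n (fun i => X i ω) x)) f) P := by
  have hk := measurable_kde hX hL h n
  have hfm := hf.measurable
  have hm : ∀ ω, Measurable (fun x => kde L h n (fun i => X i ω) x) := fun ω =>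
    hk.comp measurable_prodMk_left
  refine .of_bound (C := 1 / β * ((B / h) ^ (β - 1) * ∫ t, |L t|)
      + 1 / (β - 1) * ((B / h) ^ (β - 1) * ∫ x, f x)
      + |1 / (β * (β - 1)) * ∫ x in I, f x ^ β|) ?_ (ae_of_all _ fun ω => ?_)
  · have m1 := (StronglyMeasurable.integral_prod_right (ν := volume.restrict I)
      (f := fun ω x => T (kde L h n (fun i => X i ω) x) ^ β)
      (Measurable.stronglyMeasurable (by unfold Function.uncurry; fun_prop))).measurable
    have m2 := (StronglyMeasurable.integral_prod_right (ν := volume.restrict I)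
      (f := fun ω x => T (kde L h n (fun i => X i ω) x) ^ (β - 1) * f x)
      (Measurable.stronglyMeasurable (by unfold Function.uncurry; fun_prop))).measurable
    exact (((m1.const_mul _).sub (m2.const_mul _)).add_const _).aestronglyMeasurable
  · have hi := integrable_kde hLi hh n (fun i => X i ω)
    have hTi : Integrable (fun x => T (kde L h n (fun i => X i ω) x)) :=
      hi.mono (hTm.comp (hm ω)).aestronglyMeasurable (ae_of_all _ fun x => hT _)
    exact abs_betaDivergence_le hβ hTi (hTm.comp (hm ω))
      (fun x => (hT _).trans (abs_kde_le hB hh n _ x))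
      ((integral_mono hTi.abs hi.abs fun x => hT _).trans (integral_abs_kde_le hLi hh n _)) hf

/-- The expected divergence is bounded by the integrated moments of the error. -/
lemma enorm_integral_betaDivergence_le (hX : ∀ i, Measurable (X i)) (hf : BoundedDensity A M f)
    (hL : Continuous L) (hB : ∀ t, |L t| ≤ B) (hLi : Integrable L)
    (hTm : Measurable T) (hT : ∀ y, |T y| ≤ |y|)
    (hTf : ∀ y a, 0 ≤ a → |T y - a| ≤ |y - a|) (hβ : 1 < β) {C : ℝ}
    (hC : 0 ≤ C) (hdiv : ∀ g a, 0 ≤ a → a ≤ M →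
      |divergenceIntegrand β g a| ≤ C * (|g - a| ^ β + |g - a| ^ min β 2))
    {h : ℝ} (hh : 0 < h) (n : ℕ) :
    ‖∫ ω, betaDivergence β I (fun x => T (kde L h n (fun i => X i ω) x)) f ∂P‖ₑ ≤
      ENNReal.ofReal C *
        (∫⁻ ω, (∫⁻ x, ENNReal.ofReal (|kde L h n (fun i => X i ω) x - f x| ^ β)) ∂P
        + ∫⁻ ω, (∫⁻ x, ENNReal.ofReal (|kde L h n (fun i => X i ω) x - f x| ^ min β 2)) ∂P) := by
  have hk := measurable_kde hX hL h n
  have hfm := hf.measurable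
  have hm : ∀ ω, Measurable (fun x => kde L h n (fun i => X i ω) x) := fun ω =>
    hk.comp measurable_prodMk_left
  have hin : Measurable (fun ω =>
      ∫⁻ x, ENNReal.ofReal (|kde L h n (fun i => X i ω) x - f x| ^ β)) :=
    Measurable.lintegral_prod_right
      (f := fun ω x => ENNReal.ofReal (|kde L h n (fun i => X i ω) x - f x| ^ β))
      (by unfold Function.uncurry; fun_prop)
  refine (enorm_integral_le_lintegral_enorm _).trans ?_
  rw [← lintegral_add_left hin, ← lintegral_const_mul' _ _ ENNReal.ofReal_ne_top]
  refine lintegral_mono fun ω => ?_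
  have hi := integrable_kde hLi hh n (fun i => X i ω)
  have hTi : Integrable (fun x => T (kde L h n (fun i => X i ω) x)) :=
    hi.mono (hTm.comp (hm ω)).aestronglyMeasurable (ae_of_all _ fun x => hT _)
  refine (enorm_betaDivergence_le hβ hTi (hTm.comp (hm ω))
    (fun x => (hT _).trans (abs_kde_le hB hh n _ x)) hf).trans ?_
  have hmω := hm ω
  rw [← lintegral_add_left (by fun_prop), ← lintegral_const_mul' _ _ ENNReal.ofReal_ne_top]
  refine lintegral_mono fun x => ?_
  rw [← ENNReal.ofReal_add (by positivity) (by positivity), ← ENNReal.ofReal_mul hC]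
  refine ENNReal.ofReal_le_ofReal ((hdiv _ _ (hf.nonneg x) (hf.le x)).trans ?_)
  have hmin : 0 ≤ min β 2 := le_min (by linarith) (by norm_num)
  exact mul_le_mul_of_nonneg_left (add_le_add
    (Real.rpow_le_rpow (abs_nonneg _) (hTf _ _ (hf.nonneg x)) (by linarith))
    (Real.rpow_le_rpow (abs_nonneg _) (hTf _ _ (hf.nonneg x)) hmin)) hC

end Expectation

/-! ### Regularity of the density -/

/-- A density with compact support inside `I` which is `C⁴` on `I` is `C⁴` on the line. -/
lemma contDiff_of_tsupport_subset {f : ℝ → ℝ} {I : Set ℝ} (hI : IsOpen I) (hs : tsupport f ⊆ I)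
    {k : WithTop ℕ∞} (hf : ContDiffOn ℝ k f I) : ContDiff ℝ k f := by
  refine contDiff_iff_contDiffAt.2 fun x => ?_
  by_cases hx : x ∈ tsupport f
  · exact hf.contDiffAt (hI.mem_nhds (hs hx))
  · exact contDiffAt_const.congr_of_eventuallyEq (notMem_tsupport_iff_eventuallyEq.1 hx)

lemma exists_taylorData {f : ℝ → ℝ} (hc : HasCompactSupport f) (hf : ContDiff ℝ 4 f) :
    ∃ A M, 0 ≤ A ∧ 0 ≤ M ∧ (∀ x, f x ≤ M) ∧ TaylorData A M f (iteratedDeriv 1 f)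
      (iteratedDeriv 2 f) (iteratedDeriv 3 f) (iteratedDeriv 4 f) := by
  obtain ⟨A, hA⟩ := hc.isBounded.subset_closedBall 0
  obtain ⟨M₀, hM₀⟩ := hc.exists_bound_of_continuous hf.continuous
  have hz : ∀ x, A < |x| → ∀ k, iteratedDeriv k f x = 0 := by
    intro x hx k
    have hx' : x ∉ tsupport f := fun h => by
      have := hA h
      rw [mem_closedBall_zero_iff, Real.norm_eq_abs] at this
      linarith
    have h0 := (notMem_tsupport_iff_eventuallyEq.1 hx').iteratedDeriv_eq k
    rw [h0]
    exact iteratedDeriv_const_zero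
  have hc4 : HasCompactSupport (iteratedDeriv 4 f) := by
    refine HasCompactSupport.intro (isCompact_Icc (a := -A) (b := A)) fun x hx => hz x ?_ 4
    by_contra! h
    exact hx (abs_le.1 h)
  obtain ⟨M₁, hM₁⟩ := hc4.exists_bound_of_continuous (hf.continuous_iteratedDeriv 4 le_rfl)
  have hM₀0 := (norm_nonneg _).trans (hM₀ 0)
  have hM₁0 := (norm_nonneg _).trans (hM₁ 0)
  have hd : ∀ k : ℕ, k < 4 → ∀ x,
      HasDerivAt (iteratedDeriv k f) (iteratedDeriv (k + 1) f x) x := fun k hk x => by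
    rw [iteratedDeriv_succ]
    exact (hf.differentiable_iteratedDeriv k (by exact_mod_cast hk) x).hasDerivAt
  refine ⟨max A 0, M₀ + M₁, le_max_right _ _, by positivity, fun x => ?_, ?_⟩
  · have := (le_abs_self _).trans (hM₀ x)
    linarith
  · refine ⟨?_, hd 1 (by norm_num), hd 2 (by norm_num), hd 3 (by norm_num), fun x => ?_,
      fun x hx => ?_⟩
    · simpa using hd 0 (by norm_num)
    · have := hM₁ x
      rw [Real.norm_eq_abs] at this
      linarith
    · have hx' := (le_max_left A 0).trans_lt hx
      exact ⟨by simpa using hz x hx' 0, hz x hx' 1, hz x hx' 2, hz x hx' 3⟩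

lemma lintegral_ofReal_density_eq_one {Ω : Type*} [MeasurableSpace Ω] {P : Measure Ω}
    [IsProbabilityMeasure P] {X : Ω → ℝ} {f : ℝ → ℝ} (hX : Measurable X)
    (hlaw : P.map X = volume.withDensity (fun x => ENNReal.ofReal (f x))) :
    ∫⁻ x, ENNReal.ofReal (f x) = 1 := by
  have h1 : (P.map X) Set.univ = 1 := by
    rw [Measure.map_apply hX MeasurableSet.univ]; simp
  rwa [hlaw, withDensity_apply _ MeasurableSet.univ, Measure.restrict_univ] at h1

/-! ### Rates -/

section Rates

variable {h : ℕ → ℝ} {c : ℝ}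

lemma eventually_bandwidth (hc0 : 0 < c) (hpos : ∀ n, 0 < h n) (hlim : Tendsto h atTop (𝓝 0))
    (hsd : (fun n : ℕ => Real.sqrt (1 / (n * h n))) =O[atTop] (fun n : ℕ => (n : ℝ) ^ (-c))) :
    ∀ᶠ n : ℕ in atTop, h n ≤ 1 ∧ 1 ≤ n * h n ∧ Real.sqrt (1 / (n * h n)) ≤ 1 := by
  have ht : Tendsto (fun n : ℕ => Real.sqrt (1 / (n * h n))) atTop (𝓝 0) :=
    hsd.trans_tendsto ((tendsto_rpow_neg_atTop hc0).comp tendsto_natCast_atTop_atTop)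
  filter_upwards [hlim.eventually_le_const one_pos, ht.eventually_le_const one_pos,
    eventually_ge_atTop 1] with n h1 h2 hn
  have hn' : (0 : ℝ) < n := by exact_mod_cast hn
  refine ⟨h1, ?_, h2⟩
  have := hpos n
  rwa [Real.sqrt_le_one, div_le_one (by positivity)] at h2

lemma isBigO_natCast_rpow_neg_add (hpos : ∀ n, 0 < h n) :
    (fun n : ℕ => (n : ℝ) ^ (-c)) =O[atTop] (fun n : ℕ => (n : ℝ) ^ (-c) + h n ^ 6) := by
  refine .of_bound 1 (Eventually.of_forall fun n => ?_)
  have := hpos n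
  have h0 : 0 ≤ (n : ℝ) ^ (-c) := by positivity
  rw [one_mul, Real.norm_of_nonneg h0, Real.norm_of_nonneg (by positivity)]
  exact le_add_of_nonneg_right (by positivity)

lemma isBigO_pow_six_add (hpos : ∀ n, 0 < h n) :
    (fun n : ℕ => h n ^ 6) =O[atTop] (fun n : ℕ => (n : ℝ) ^ (-c) + h n ^ 6) := by
  refine .of_bound 1 (Eventually.of_forall fun n => ?_)
  have := hpos n
  have h0 : 0 ≤ (n : ℝ) ^ (-c) := by positivity
  rw [one_mul, Real.norm_of_nonneg (by positivity), Real.norm_of_nonneg (by positivity)]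
  exact le_add_of_nonneg_left h0

/-- The `p`-th powers of the stochastic rate and of the bias rate are within the claimed error. The bias
`h⁴` contributes `h ^ (4 p)`, which is at most `h⁶` exactly from `p = 3 / 2` on. -/
lemma isBigO_error_rate (hc0 : 0 < c) (hpos : ∀ n, 0 < h n) (hlim : Tendsto h atTop (𝓝 0))
    (hsd : (fun n : ℕ => Real.sqrt (1 / (n * h n))) =O[atTop] (fun n : ℕ => (n : ℝ) ^ (-c)))
    {p : ℝ} (hp : 1 < p)
    (hbias : p < 3 / 2 → (fun n : ℕ => h n ^ 4) =O[atTop] (fun n : ℕ => (n : ℝ) ^ (-c))) :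
    (fun n : ℕ => Real.sqrt (1 / (n * h n)) ^ p + (h n ^ 4) ^ p)
      =O[atTop] (fun n : ℕ => (n : ℝ) ^ (-c) + h n ^ 6) := by
  have hev := eventually_bandwidth hc0 hpos hlim hsd
  refine IsBigO.add ?_ ?_
  · refine IsBigO.trans (.of_bound 1 ?_) (hsd.trans (isBigO_natCast_rpow_neg_add hpos))
    filter_upwards [hev] with n hn
    have hs := Real.sqrt_nonneg (1 / (n * h n))
    rw [one_mul, Real.norm_of_nonneg (by positivity), Real.norm_of_nonneg hs]
    simpa using Real.rpow_le_rpow_of_exponent_ge' hs hn.2.2 zero_le_one hp.le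
  · rcases lt_or_ge p (3 / 2) with hp2 | hp2
    · refine IsBigO.trans (.of_bound 1 ?_)
        ((hbias hp2).trans (isBigO_natCast_rpow_neg_add hpos))
      filter_upwards [hev] with n hn
      have hs := hpos n
      rw [one_mul, Real.norm_of_nonneg (by positivity), Real.norm_of_nonneg (by positivity)]
      simpa using Real.rpow_le_rpow_of_exponent_ge' (pow_nonneg hs.le 4)
        (pow_le_one₀ hs.le hn.1) zero_le_one hp.le
    · refine IsBigO.trans (.of_bound 1 ?_) (isBigO_pow_six_add hpos)
      filter_upwards [hev] with n hn
      have hs := hpos n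
      rw [one_mul, Real.norm_of_nonneg (by positivity), Real.norm_of_nonneg (by positivity)]
      refine (Real.rpow_le_rpow_of_exponent_ge' (pow_nonneg hs.le 4)
        (pow_le_one₀ hs.le hn.1) (by norm_num) hp2).trans_eq ?_
      rw [← Real.rpow_natCast (h n) 4, ← Real.rpow_mul hs.le, ← Real.rpow_natCast (h n) 6]
      norm_num

/-- The asymptotic expected divergence is itself of the order of the claimed error. -/
lemma isBigO_asympExpectedBetaDivergence (hc0 : 0 < c) (hpos : ∀ n, 0 < h n)
    (hlim : Tendsto h atTop (𝓝 0))
    (hsd : (fun n : ℕ => Real.sqrt (1 / (n * h n))) =O[atTop] (fun n : ℕ => (n : ℝ) ^ (-c)))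
    (β : ℝ) (I : Set ℝ) (K f : ℝ → ℝ) :
    (fun n : ℕ => asympExpectedBetaDivergence β I K f n (h n))
      =O[atTop] (fun n : ℕ => (n : ℝ) ^ (-c) + h n ^ 6) := by
  have hev := eventually_bandwidth hc0 hpos hlim hsd
  have h8 : (fun n : ℕ => h n ^ 8) =O[atTop] (fun n : ℕ => (n : ℝ) ^ (-c) + h n ^ 6) := by
    refine IsBigO.trans (.of_bound 1 ?_) (isBigO_pow_six_add hpos)
    filter_upwards [hev] with n hn
    have hs := hpos n
    rw [one_mul, Real.norm_of_nonneg (by positivity), Real.norm_of_nonneg (by positivity)]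
    exact pow_le_pow_of_le_one hs.le hn.1 (by norm_num)
  have h1 : (fun n : ℕ => 1 / (n * h n)) =O[atTop] (fun n : ℕ => (n : ℝ) ^ (-c) + h n ^ 6) := by
    refine IsBigO.trans (.of_bound 1 ?_) (hsd.trans (isBigO_natCast_rpow_neg_add hpos))
    filter_upwards [hev] with n hn
    have h0 : 0 ≤ 1 / (n * h n) := by have := hpos n; positivity
    have hs := Real.sqrt_nonneg (1 / (n * h n))
    rw [one_mul, Real.norm_of_nonneg h0, Real.norm_of_nonneg hs]
    nlinarith [Real.sq_sqrt h0, hn.2.2]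
  set a := (∫ t, t ^ 4 * K t) ^ 2 * (∫ x in I, f x ^ (β - 2) * (iteratedDeriv 4 f x) ^ 2)
  set b := (∫ t, K t ^ 2) * (∫ x in I, f x ^ (β - 1))
  refine ((h8.const_mul_left (a / 1152)).add (h1.const_mul_left (b / 2))).congr_left fun n => ?_
  simp only [asympExpectedBetaDivergence, a, b]
  ring

end Rates

theorem proposition1
    {Ω : Type*} [MeasurableSpace Ω] (P : Measure Ω) [IsProbabilityMeasure P]
    (β : ℝ) (hβ : 1 < β)
    (K : ℝ → ℝ) (hK : IsSmoothKernel K)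
    -- the density `f`: compactly supported in the open interval `I`, four times continuously
    -- differentiable on `I`, with a finite integral of `f ^ (β - 2) (f⁽⁴⁾)²` over `I`
    (I : Set ℝ) (hIopen : IsOpen I) (hIconn : I.OrdConnected)
    (f : ℝ → ℝ) (hf0 : ∀ x, 0 ≤ f x)
    (hF1 : HasCompactSupport f) (hF1' : tsupport f ⊆ I)
    (hF2 : ContDiffOn ℝ 4 f I)
    (hF3 : IntegrableOn (fun x => (iteratedDeriv 4 f x) ^ 2 * f x ^ (β - 2)) I)
    -- an i.i.d. sample with density `f`
    (X : ℕ → Ω → ℝ) (hXmeas : ∀ i, Measurable (X i)) (hXindep : iIndepFun X P)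
    (hXlaw : ∀ i, P.map (X i) = volume.withDensity (fun x => ENNReal.ofReal (f x)))
    (c : ℝ) (hc0 : 0 < c) (hc : c < 1 / 8)
    -- the bandwidths
    (h : ℕ → ℝ) (hpos : ∀ n, 0 < h n) (hlim : Tendsto h atTop (𝓝 0))
    (hsd : (fun n : ℕ => Real.sqrt (1 / (n * h n))) =O[atTop] (fun n : ℕ => (n : ℝ) ^ (-c)))
    (hbias : β < 3 / 2 → (fun n : ℕ => h n ^ 4) =O[atTop] (fun n : ℕ => (n : ℝ) ^ (-c)))
    -- the estimator is used either as it is or through its positive part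
    (T : ℝ → ℝ) (hT : T = id ∨ T = fun y => max y 0) :
    (∀ n : ℕ, 1 ≤ n →
      (∀ ω,
        IntegrableOn
          (fun x => T (biasReducedKde K (h n) n (fun i => X i ω) x) ^ β) I ∧
        IntegrableOn
          (fun x => T (biasReducedKde K (h n) n (fun i => X i ω) x) ^ (β - 1) * f x) I) ∧
      Integrable
        (fun ω => betaDivergence β I
          (fun x => T (biasReducedKde K (h n) n (fun i => X i ω) x)) f) P) ∧
    IntegrableOn (fun x => f x ^ β) I ∧
    IntegrableOn (fun x => f x ^ (β - 1)) I ∧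
    Integrable (fun t => K t ^ 2) ∧
    (fun n : ℕ =>
        (∫ ω, betaDivergence β I
          (fun x => T (biasReducedKde K (h n) n (fun i => X i ω) x)) f ∂P)
        - asympExpectedBetaDivergence β I K f n (h n))
      =O[atTop] (fun n : ℕ => (n : ℝ) ^ (-c) + h n ^ 6) := by
  have hTm : Measurable T := by
    rcases hT with rfl | rfl
    · exact measurable_id
    · fun_prop
  have hTabs : ∀ y, |T y| ≤ |y| := by
    rcases hT with rfl | rfl <;> intro y
    · exact le_rfl
    · simpa using abs_max_sub_max_le_abs y 0 0
  have hTf : ∀ y a, 0 ≤ a → |T y - a| ≤ |y - a| := by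
    rcases hT with rfl | rfl <;> intro y a ha
    · exact le_rfl
    · simpa [max_eq_left ha] using abs_max_sub_max_le_abs y a 0
  have hfC := contDiff_of_tsupport_subset hIopen hF1' hF2
  obtain ⟨A, M, hA, hM, hfM, hfT⟩ := exists_taylorData hF1 hfC
  have hfD : BoundedDensity A M f :=
    ⟨hfC.continuous.measurable, hf0, hfM, fun x hx => (hfT.supp x hx).1,
      lintegral_ofReal_density_eq_one (hXmeas 0) (hXlaw 0)⟩
  -- an opaque name keeps the unifier from unfolding the kernel
  obtain ⟨L, hLdef⟩ : ∃ L, L = biasReducedKernel K := ⟨_, rfl⟩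
  have hL : Continuous L := hLdef ▸ hK.continuous_biasReducedKernel
  have hLi : Integrable L := hLdef ▸ hK.integrable_biasReducedKernel
  obtain ⟨B, hB0, hB⟩ : ∃ B : ℝ, 0 < B ∧ ∀ t, |L t| ≤ B := hLdef ▸ hK.bounded_biasReducedKernel
  have hkde : ∀ n (Y : ℕ → ℝ) x, biasReducedKde K (h n) n Y x = kde L (h n) n Y x := fun n Y x =>
    hLdef ▸ biasReducedKde_eq hK.contDiff (hpos n) n Y x
  simp only [hkde]
  refine ⟨fun n _ => ⟨fun ω => ?_, ?_⟩, ?_, ?_, ?_, IsBigO.sub ?_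
    (isBigO_asympExpectedBetaDivergence hc0 hpos hlim hsd β I K f)⟩
  · have hm : Measurable (fun x => kde L (h n) n (fun i => X i ω) x) :=
      (measurable_kde hXmeas hL (h n) n).comp measurable_prodMk_left
    have hi := integrable_kde hLi (hpos n) n (fun i => X i ω)
    have hTi : Integrable (fun x => T (kde L (h n) n (fun i => X i ω) x)) :=
      hi.mono (hTm.comp hm).aestronglyMeasurable (ae_of_all _ fun x => hTabs _)
    have hb := fun x => (hTabs _).trans (abs_kde_le hB (hpos n) n (fun i => X i ω) x)
    exact ⟨(integrable_rpow_of_bounded hβ hTi (hTm.comp hm) hb).1.integrableOn,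
      (integrable_rpow_mul_of_bounded hβ (hTm.comp hm) hb hfD).1.integrableOn⟩
  · exact integrable_betaDivergence_kde hXmeas hfD hL hB hLi hTm hTabs hβ (hpos n) n
  · exact (hfD.integrable_rpow (by linarith)).integrableOn
  · exact (hfD.integrable_rpow (by linarith)).integrableOn
  · obtain ⟨N, hN⟩ := hK.bounded
    exact integrable_sq_of_bounded hK.contDiff.continuous hN hK.integrable
  · obtain ⟨C, hC, hdiv⟩ := exists_abs_divergenceIntegrand_le hβ hM
    have hm1 : 1 < min β 2 := lt_min hβ (by norm_num)
    obtain ⟨C₁, hC₁, e1⟩ := exists_lintegral_kde_error_le hXmeas hXindep hA hfD hM hfT hXlaw hK hβ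
    obtain ⟨C₂, hC₂, e2⟩ :=
      exists_lintegral_kde_error_le hXmeas hXindep hA hfD hM hfT hXlaw hK hm1
    rw [← hLdef] at e1 e2
    have r1 := isBigO_error_rate hc0 hpos hlim hsd hβ hbias
    have r2 := isBigO_error_rate hc0 hpos hlim hsd hm1 fun hlt => hbias (by
      rcases min_lt_iff.1 hlt with h | h
      · exact h
      · norm_num at h)
    refine IsBigO.trans (.of_bound C ?_) ((r1.const_mul_left C₁).add (r2.const_mul_left C₂))
    filter_upwards [eventually_bandwidth hc0 hpos hlim hsd] with n hn
    have hh := hpos n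
    set s := Real.sqrt (1 / (n * h n)) with hs
    have hs0 : 0 ≤ s := Real.sqrt_nonneg _
    have key := enorm_integral_betaDivergence_le (P := P) (I := I) hXmeas hfD hL hB hLi hTm hTabs
      hTf hβ hC hdiv hh n
    have key2 := key.trans (mul_le_mul_right (add_le_add (e1 n (h n) hh hn.1 hn.2.1)
      (e2 n (h n) hh hn.1 hn.2.1)) _)
    rw [← ENNReal.ofReal_add (by positivity) (by positivity), ← ENNReal.ofReal_mul hC,
      ← ofReal_norm, ENNReal.ofReal_le_ofReal_iff (by positivity)] at key2
    refine key2.trans ?_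
    gcongr
    exact le_abs_self _
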